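/- Let $p_1,q_1,p_2,q_2>0$ with $p_1+q_1+p_2+q_2=1$, and put $h_i=p_i+q_i$. Let $(S_n)_{n\ge 0}$ be the random walk on $\mathbb Z^2$ with $S_0=(0,0)$ and i.i.d. increments equal to $(1,0),(-1,0),(0,1),(0,-1)$ with probabilities $p_1,q_1,p_2,q_2$ respectively. Write $S_n=(S^1_n,S^2_n)$ and, for $i=1,2$, let $$N^i_n=\#\{1\le k\le n : S^i_k=0,\ S^i_{k-1}\neq 0\},\qquad \tau=\inf\{n\ge 1 : S^1_n<0\text{ or }S^2_n<0\}.$$ For $r\in\mathbb N=\{0,1,2,\dots\}$ put $$\rho_i=\frac{\sqrt{4p_iq_i}}{h_i},\qquad \phi_i(0,r)=\frac{a_i+(1-a_i)r}{2^{r+1}},\qquad \phi_i(1,r)=\frac{b_i+(1-b_i)r}{2^{r+1}},\qquad a_i=\frac{2p_i}{h_i},\quad b_i=\frac{h_i}{2q_i},$$ and for $0<\alpha\le 1$ let $\mathcal G(\alpha)$ be the law on $\mathbb N$ giving mass $\alpha(1-\alpha)^k$ to $k$. Then, as $n\to\infty$ through the even integers, the law of $(N^1_n,N^2_n)$ conditional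 on $\tau>n$ (an event of positive probability) converges weakly to the law of a pair $(X_1,X_2)$ of $\mathbb N$-valued random variables such that: 1. if $p_1\ge q_1$ and $p_2\ge q_2$, then $X_1$ and $X_2$ are independent and $X_i$ has law $\mathcal G(p_i/h_i)$ for $i=1,2$; 2. if $p_i<q_i$ and $p_j\ge q_j$, where $\{i,j\}=\{1,2\}$, then $X_1$ and $X_2$ are independent, $X_j$ has law $\mathcal G(p_j/h_j)$, and for all $r\in\mathbb N$ $$\mathbb P(X_i=r)=\frac{\phi_i(0,r)+\rho_i\,\phi_i(1,r)}{1+\rho_i};$$ 3. if $p_1<q_1$ and $p_2<q_2$, then $X_1$ and $X_2$ are not independent, and for all $r_1,r_2\in\mathbb N$ $$\mathbb P(X_1=r_1,X_2=r_2)=\frac{\phi_1(0,r_1)\phi_2(0,r_2)+\rho_1\rho_2\,\phi_1(1,r_1)\phi_2(1,r_2)}{1+\rho_1\rho_2}.$$ -/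

import Mathlib

open MeasureTheory ProbabilityTheory Filter

namespace QuadrantWalk

/-- The walk on `ℤ²` started at the origin with increments `ξ 0, ξ 1, …`, after `n` steps:
`ξ k` is the `(k+1)`-st increment, `walk ξ (k + 1) - walk ξ k`. -/
def walk {Ω : Type*} (ξ : ℕ → Ω → Fin 2 → ℤ) (n : ℕ) (ω : Ω) : Fin 2 → ℤ :=
  ∑ k ∈ Finset.range n, ξ k ω

/-- The number of (strict) returns to zero of the `i`-th coordinate of the walk up to time `n`:
the number of times `1 ≤ k ≤ n` at which that coordinate is zero but was not zero just before. -/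
def returns {Ω : Type*} (ξ : ℕ → Ω → Fin 2 → ℤ) (i : Fin 2) (n : ℕ) (ω : Ω) : ℕ :=
  ((Finset.Icc 1 n).filter fun k => walk ξ k ω i = 0 ∧ walk ξ (k - 1) ω i ≠ 0).card

/-- The exit time of the walk from the quadrant `ℕ²`: the first `n ≥ 1` at which some coordinate
is negative, and `⊤` if there is none. -/
noncomputable def exitTime {Ω : Type*} (ξ : ℕ → Ω → Fin 2 → ℤ) (ω : Ω) : ℕ∞ :=
  ⨅ n ∈ {n : ℕ | 1 ≤ n ∧ ∃ i, walk ξ n ω i < 0}, (n : ℕ∞)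

/-- The event that the walk has not left the quadrant up to time `n`. -/
def survival {Ω : Type*} (ξ : ℕ → Ω → Fin 2 → ℤ) (n : ℕ) : Set Ω :=
  {ω | (n : ℕ∞) < exitTime ξ ω}

/-- The probability `p / (p + q)` as an element of the unit interval. -/
noncomputable def upProb {p q : ℝ} (hp : 0 < p) (hq : 0 < q) : unitInterval :=
  ⟨p / (p + q), by positivity, (div_le_one (by positivity)).2 (by linarith)⟩

/-- The factor `√(4 p q) / (p + q)`. -/
noncomputable def rho (p q : ℝ) : ℝ := √(4 * p * q) / (p + q)

/-- The weight `(a + (1 - a) r) / 2 ^ (r + 1)` with `a = 2 p / (p + q)`. -/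
noncomputable def phiEven (p q : ℝ) (r : ℕ) : ℝ :=
  (2 * p / (p + q) + (1 - 2 * p / (p + q)) * r) / 2 ^ (r + 1)

/-- The weight `(b + (1 - b) r) / 2 ^ (r + 1)` with `b = (p + q) / (2 q)`. -/
noncomputable def phiOdd (p q : ℝ) (r : ℕ) : ℝ :=
  ((p + q) / (2 * q) + (1 - (p + q) / (2 * q)) * r) / 2 ^ (r + 1)

end QuadrantWalk

/-! A path of `n` steps in the quadrant is a shuffle of two nonnegative one-dimensional paths with
`i` and `j = n - i` steps, and shuffling changes neither survival nor the numbers of strict returns.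
So the probabilities of survival and of prescribed return numbers are binomial convolutions of
one-dimensional weights (`measureReal_returnEvent`, `measureReal_survival`).

In one dimension with `P + Q = 1`, let `e` be the generating function of excursions and `U` that of
survival up to even times. Then `e = PQ X + e²` and `e U = Q (U - 1)`, and the weights with `r`
returns are coefficients of `e^r (1 - e) U` at even times and of `e^r (1 - e) (U - 1)` at odd times
(`stayWeight_even_odd`). Ratio limits of Catalan numbers then give the limit law of the number of
returns given survival, separately for each parity. If `Q ≤ P`, excursion weights are negligible
against survival and both laws are the same geometric law. If `P < Q`, they are comparable, and the
even and odd laws differ.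

In a binomial convolution of positive sequences with convergent ratios, the alternating sum is
negligible (`tendsto_binomConv_alternating`), so even and odd `i` carry asymptotically equal weight.
For even `n` the indices `i` and `j` have the same parity. The limit is therefore a mixture of (even
law) × (even law) and (odd law) × (odd law) with weights in the ratio `1 : ρ₁ρ₂`, where `ρ` is read
as `1` for a coordinate with `q ≤ p` (`tendsto_returnEvent`). A coordinate whose two laws agree
makes the mixture a product; if both coordinates have distinct laws, the mixture is dependent.
Convergence of point masses to a probability law on a countable discrete space is weak convergence.
-/

namespace QuadrantWalk

/-! ### Catalan generating functions for excursions and for survival. -/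

section GeneratingFunctions

open PowerSeries

/-- The Catalan generating function at `t * X`. -/
noncomputable def catalanGF (t : ℝ) : PowerSeries ℝ :=
  rescale t (map (Nat.castRingHom ℝ) catalanSeries)

/-- The generating function of the excursion weights `t ^ m * catalan (m - 1)`, `m ≥ 1`. -/
noncomputable def excursionGF (t : ℝ) : PowerSeries ℝ := C t * X * catalanGF t

lemma catalanGF_eq (t : ℝ) : catalanGF t = 1 + C t * X * catalanGF t ^ 2 := by
  have h := congrArg (fun f => rescale t (map (Nat.castRingHom ℝ) f))
    catalanSeries_sq_mul_X_add_one
  simp only [map_add, map_mul, map_pow, map_one, map_X, rescale_X] at h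
  rw [catalanGF]
  linear_combination -h

/-- This quadratic equation later turns the powers of the series into a two-term recursion. -/
lemma excursionGF_eq (t : ℝ) : excursionGF t = C t * X + excursionGF t ^ 2 := by
  rw [excursionGF]
  linear_combination C t * X * catalanGF_eq t

lemma coeff_zero_excursionGF (t : ℝ) : coeff 0 (excursionGF t) = 0 := by
  simp [excursionGF]

lemma coeff_succ_excursionGF (t : ℝ) (m : ℕ) :
    coeff (m + 1) (excursionGF t) = t ^ (m + 1) * catalan m := by
  simp [excursionGF, mul_assoc, catalanGF, coeff_rescale, pow_succ']

lemma coeff_excursionGF_pow_eq_zero (t : ℝ) {m r : ℕ} (h : m < r) (f : PowerSeries ℝ) :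
    coeff m (excursionGF t ^ r * f) = 0 := by
  have : excursionGF t ^ r * f = X ^ r * ((C t * catalanGF t) ^ r * f) := by
    rw [excursionGF]; ring
  rw [this, coeff_X_pow_mul', if_neg (by omega)]

/-- The generating function of the probabilities that a walk with step probabilities `P`, `Q`
stays nonnegative for `2 * m` steps. -/
noncomputable def stayGF (P Q : ℝ) : PowerSeries ℝ :=
  (1 - C P⁻¹ * excursionGF (P * Q)) * mk 1

variable {P Q : ℝ}

/-- The walk first goes below zero at an odd time `2j - 1`. Prepending an up-step to such a path
gives an excursion of length `2j`, so this has probability `P⁻¹` times the `j`-th excursion weight;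
division by `1 - X` sums these losses. -/
lemma one_sub_X_mul_stayGF (P Q : ℝ) :
    (1 - X) * stayGF P Q = 1 - C P⁻¹ * excursionGF (P * Q) := by
  have h := mk_one_mul_one_sub_eq_one ℝ
  rw [stayGF]
  linear_combination (1 - C P⁻¹ * excursionGF (P * Q)) * h

lemma C_mul_one_sub_X_mul_stayGF (hP : P ≠ 0) :
    C P * ((1 - X) * stayGF P Q) = C P - excursionGF (P * Q) := by
  have h : (C P : PowerSeries ℝ) * C P⁻¹ = 1 := by
    rw [← map_mul, mul_inv_cancel₀ hP, map_one]
  rw [one_sub_X_mul_stayGF]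
  linear_combination (-excursionGF (P * Q)) * h

lemma excursionGF_mul_stayGF (hP : P ≠ 0) (hPQ : P + Q = 1) :
    excursionGF (P * Q) * stayGF P Q = C Q * (stayGF P Q - 1) := by
  have h1 := C_mul_one_sub_X_mul_stayGF (Q := Q) hP
  have h2 := excursionGF_eq (P * Q)
  have h3 : (C P : PowerSeries ℝ) + C Q = 1 := by rw [← map_add, hPQ, map_one]
  rw [map_mul] at h2
  have hP' : (C P : PowerSeries ℝ) ≠ 0 := by
    rwa [Ne, map_eq_zero_iff _ (C_injective (R := ℝ))]
  have hX : (1 - X : PowerSeries ℝ) ≠ 0 := by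
    intro h
    have := congrArg (coeff 0) h
    simp at this
  -- Multiplied by `P (1 - X)`, both sides become polynomials in `e` and `X`, and the claim reduces
  -- to `e = PQ X + e²`.
  apply mul_left_cancel₀ (mul_ne_zero hP' hX)
  linear_combination (excursionGF (P * Q) - C Q) * h1 + h2 + excursionGF (P * Q) * h3

lemma coeff_zero_stayGF (P Q : ℝ) : coeff 0 (stayGF P Q) = 1 := by
  have := coeff_zero_excursionGF (P * Q)
  simp only [coeff_zero_eq_constantCoeff] at this
  simp [stayGF, this]

lemma coeff_succ_stayGF (P Q : ℝ) (m : ℕ) :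
    coeff (m + 1) (stayGF P Q)
      = coeff m (stayGF P Q) - P⁻¹ * coeff (m + 1) (excursionGF (P * Q)) := by
  have h := congrArg (coeff (m + 1)) (one_sub_X_mul_stayGF P Q)
  simp only [sub_mul, one_mul, map_sub, coeff_succ_X_mul, coeff_C_mul] at h
  rw [coeff_one, if_neg (by omega)] at h
  linarith

end GeneratingFunctions

/-! ### One-dimensional nonnegative paths counted by endpoint and returns. -/

section PathWeights

open PowerSeries

/-- The weight of the nonnegative paths from `0` to `x` with `k` steps and `r` returns to zero,
up-steps having weight `P` and down-steps weight `Q`. -/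
def pathWeight (P Q : ℝ) : ℕ → ℕ → ℕ → ℝ
  | 0, x, r => if x = 0 ∧ r = 0 then 1 else 0
  | _ + 1, 0, 0 => 0
  | k + 1, 0, r + 1 => Q * pathWeight P Q k 1 r
  | k + 1, x + 1, r => P * pathWeight P Q k x r + Q * pathWeight P Q k (x + 2) r

variable {P Q : ℝ}

/-- Decompose at last exits: `r` excursions, then for each of the `x` levels climbed one final
up-step followed by a loop staying above that level. The induction removes the last step and uses
`c^(x+1) = c^x + PQ X c^(x+2)` for the Catalan series `c`. -/
lemma pathWeight_eq (P Q : ℝ) (k x r : ℕ) :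
    (∀ m, k = 2 * m + x → pathWeight P Q k x r
      = P ^ x * coeff m (excursionGF (P * Q) ^ r * catalanGF (P * Q) ^ x)) ∧
    ((∀ m, k ≠ 2 * m + x) → pathWeight P Q k x r = 0) := by
  induction k generalizing x r with
  | zero =>
    constructor
    · intro m hm
      obtain ⟨rfl, rfl⟩ : m = 0 ∧ x = 0 := by omega
      rcases r with _ | r
      · simp [pathWeight]
      · rw [coeff_excursionGF_pow_eq_zero _ (by omega)]
        simp [pathWeight]
    · intro h
      have := h 0
      rw [pathWeight, if_neg]
      omega
  | succ k ih =>
    rcases x with _ | x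
    · rcases r with _ | r
      · refine ⟨fun m hm => ?_, fun _ => by rw [pathWeight]⟩
        rw [pathWeight, pow_zero, pow_zero, pow_zero, one_mul, one_mul, coeff_one,
          if_neg (by omega)]
      · constructor
        · intro m hm
          obtain ⟨m, rfl⟩ : ∃ m', m = m' + 1 := ⟨m - 1, by omega⟩
          rw [pathWeight, (ih 1 r).1 m (by omega)]
          have : excursionGF (P * Q) ^ (r + 1) * catalanGF (P * Q) ^ 0
              = X * (C (P * Q) * (excursionGF (P * Q) ^ r * catalanGF (P * Q) ^ 1)) := by
            rw [pow_succ (excursionGF _)]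
            nth_rewrite 2 [excursionGF]
            ring
          rw [this, coeff_succ_X_mul, coeff_C_mul]
          ring
        · intro h
          rw [pathWeight, (ih 1 r).2, mul_zero]
          intro m hm
          exact h (m + 1) (by omega)
    · constructor
      · intro m hm
        have key : excursionGF (P * Q) ^ r * catalanGF (P * Q) ^ (x + 1)
            = excursionGF (P * Q) ^ r * catalanGF (P * Q) ^ x
              + X * (C (P * Q) * (excursionGF (P * Q) ^ r * catalanGF (P * Q) ^ (x + 2))) := by
          linear_combination excursionGF (P * Q) ^ r * catalanGF (P * Q) ^ x
            * catalanGF_eq (P * Q)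
        rw [pathWeight, (ih x r).1 m (by omega), key, map_add]
        rcases m with _ | m
        · rw [(ih (x + 2) r).2 (by omega)]
          simp
          ring
        · rw [(ih (x + 2) r).1 m (by omega), coeff_succ_X_mul, coeff_C_mul]
          ring
      · intro h
        rw [pathWeight, (ih x r).2, (ih (x + 2) r).2]
        · ring
        · intro m hm
          exact h (m + 1) (by omega)
        · intro m hm
          exact h m (by omega)

lemma pathWeight_eq_zero_of_lt {k x : ℕ} (h : k < x) (r : ℕ) : pathWeight P Q k x r = 0 :=
  (pathWeight_eq P Q k x r).2 (by omega)

lemma pathWeight_even_zero (m r : ℕ) :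
    pathWeight P Q (2 * m) 0 r = coeff m (excursionGF (P * Q) ^ r) := by
  simpa using (pathWeight_eq P Q (2 * m) 0 r).1 m (by omega)

lemma pathWeight_odd_zero (m r : ℕ) : pathWeight P Q (2 * m + 1) 0 r = 0 :=
  (pathWeight_eq P Q (2 * m + 1) 0 r).2 (by omega)

/-- The weight of the nonnegative paths with `k` steps and `r` returns to zero. -/
def stayWeight (P Q : ℝ) (k r : ℕ) : ℝ := ∑ x ∈ Finset.range (k + 1), pathWeight P Q k x r

lemma sum_range_pathWeight {k n : ℕ} (h : k ≤ n) (r : ℕ) :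
    ∑ x ∈ Finset.range (n + 1), pathWeight P Q k x r = stayWeight P Q k r := by
  symm
  apply Finset.sum_subset
  · intro x; simp; omega
  · intro x _ hx
    apply pathWeight_eq_zero_of_lt
    simpa using hx

/-- A mass balance: down-steps from zero are killed, paths arriving at zero move from class `r` to
`r + 1`, and arrivals from class `r - 1` are gained. -/
lemma stayWeight_succ (hPQ : P + Q = 1) (k r : ℕ) :
    stayWeight P Q (k + 1) r = stayWeight P Q k r - Q * pathWeight P Q k 0 r
      - pathWeight P Q (k + 1) 0 (r + 1) + pathWeight P Q (k + 1) 0 r := by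
  rw [stayWeight, Finset.sum_range_succ', add_left_inj]
  have h1 : stayWeight P Q k r = ∑ x ∈ Finset.range (k + 1), pathWeight P Q k x r := rfl
  have h2 := sum_range_pathWeight (P := P) (Q := Q) (k := k) (n := k + 2) (by omega) r
  rw [Finset.sum_range_succ', Finset.sum_range_succ'] at h2
  simp only [pathWeight, Finset.sum_add_distrib, ← Finset.mul_sum]
  rw [← h1]
  have h3 : ∑ x ∈ Finset.range (k + 1), pathWeight P Q k (x + 2) r
      = stayWeight P Q k r - pathWeight P Q k 1 r - pathWeight P Q k 0 r := by
    rw [← h2]; ring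
  rw [h3]
  linear_combination stayWeight P Q k r * hPQ

/-- `e^r U` counts paths with at least `r` returns: `r` excursions, then any surviving continuation;
subtracting the same for `r + 1` gives the factor `1 - e`. At odd times the continuation has odd
length `2j + 1`, and surviving it is the same as surviving `2j + 2` steps, which explains `U - 1`
and the shift of the index. -/
lemma stayWeight_even_odd (hP : P ≠ 0) (hPQ : P + Q = 1) (m r : ℕ) :
    stayWeight P Q (2 * m) r
      = coeff m (excursionGF (P * Q) ^ r * (1 - excursionGF (P * Q)) * stayGF P Q) ∧
    stayWeight P Q (2 * m + 1) r
      = coeff (m + 1) (excursionGF (P * Q) ^ r * (1 - excursionGF (P * Q))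
          * (stayGF P Q - 1)) := by
  set e := excursionGF (P * Q) with he
  set U := stayGF P Q with hU
  -- The balance for the step from time `2m` to `2m + 1`: no return to zero is possible, and the
  -- only loss is a down-step from zero.
  have key : e ^ r * (1 - e) * (U - 1)
      = X * (e ^ r * (1 - e) * U) - X * (C Q * e ^ r) := by
    have h1 := C_mul_one_sub_X_mul_stayGF (Q := Q) hP
    have h2 := excursionGF_mul_stayGF hP hPQ
    have h3 : (C P : PowerSeries ℝ) + C Q = 1 := by rw [← map_add, hPQ, map_one]
    rw [← he, ← hU] at h1 h2
    linear_combination e ^ r * (h1 - h2 - (U * (1 - X) - 1) * h3 + X * h2)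
  have odd_of_even : ∀ m, stayWeight P Q (2 * m) r = coeff m (e ^ r * (1 - e) * U) →
      stayWeight P Q (2 * m + 1) r = coeff (m + 1) (e ^ r * (1 - e) * (U - 1)) := by
    intro m hm
    rw [stayWeight_succ hPQ, hm, pathWeight_odd_zero, pathWeight_odd_zero, pathWeight_even_zero,
      key, map_sub, coeff_succ_X_mul, coeff_succ_X_mul, coeff_C_mul]
    ring
  suffices h : stayWeight P Q (2 * m) r = coeff m (e ^ r * (1 - e) * U) from
    ⟨h, odd_of_even m h⟩
  induction m with
  | zero =>
    have hU0 := coeff_zero_stayGF P Q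
    have he0 := coeff_zero_excursionGF (P * Q)
    rw [← hU] at hU0
    rw [← he] at he0
    simp only [coeff_zero_eq_constantCoeff] at hU0 he0
    rcases r with _ | r
    · simp [stayWeight, pathWeight, hU0, he0]
    · simp [stayWeight, pathWeight, he0]
  | succ m ih =>
    have h := stayWeight_succ hPQ (2 * m + 1) r
    rw [odd_of_even m ih, pathWeight_odd_zero, show 2 * m + 1 + 1 = 2 * (m + 1) by ring,
      pathWeight_even_zero, pathWeight_even_zero, ← he] at h
    rw [h]
    have : e ^ r * (1 - e) * U = e ^ r * (1 - e) * (U - 1) + (e ^ r - e ^ (r + 1)) := by ring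
    rw [this, map_add, map_sub]
    ring

lemma sum_stayWeight_even (hP : P ≠ 0) (hPQ : P + Q = 1) {m n : ℕ} (h : m ≤ n) :
    ∑ r ∈ Finset.range (n + 1), stayWeight P Q (2 * m) r = coeff m (stayGF P Q) := by
  simp only [(stayWeight_even_odd hP hPQ m _).1]
  rw [← map_sum, ← Finset.sum_mul, ← Finset.sum_mul, geom_sum_mul_neg, sub_mul, map_sub,
    coeff_excursionGF_pow_eq_zero _ (by omega), one_mul, sub_zero]

lemma sum_stayWeight_odd (hP : P ≠ 0) (hPQ : P + Q = 1) {m n : ℕ} (h : m + 1 ≤ n) :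
    ∑ r ∈ Finset.range (n + 1), stayWeight P Q (2 * m + 1) r
      = coeff (m + 1) (stayGF P Q) := by
  simp only [(stayWeight_even_odd hP hPQ m _).2]
  rw [← map_sum, ← Finset.sum_mul, ← Finset.sum_mul, geom_sum_mul_neg, sub_mul, map_sub,
    coeff_excursionGF_pow_eq_zero _ (by omega), one_mul, sub_zero, map_sub, coeff_one,
    if_neg (by omega), sub_zero]

end PathWeights

/-! ### Growth and ratio limits of the excursion weights. -/

section Excursions

open PowerSeries Topology

/-- The excursion weights. -/
noncomputable def exc (t : ℝ) (m : ℕ) : ℝ := coeff m (excursionGF t)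

/-- The probability of staying nonnegative for `2 * m` steps. -/
noncomputable def stay (P Q : ℝ) (m : ℕ) : ℝ := coeff m (stayGF P Q)

lemma exc_succ (t : ℝ) (m : ℕ) : exc t (m + 1) = t ^ (m + 1) * catalan m :=
  coeff_succ_excursionGF t m

lemma exc_succ_pos {t : ℝ} (ht : 0 < t) (m : ℕ) : 0 < exc t (m + 1) := by
  have h := succ_mul_catalan_eq_centralBinom m
  have h2 := Nat.centralBinom_pos m
  have : 0 < catalan m := by
    rcases Nat.eq_zero_or_pos (catalan m) with h0 | h0
    · rw [h0] at h; omega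
    · exact h0
  rw [exc_succ]
  positivity

lemma exc_nonneg {t : ℝ} (ht : 0 < t) (m : ℕ) : 0 ≤ exc t m := by
  rcases m with _ | m
  · exact (coeff_zero_excursionGF t).ge
  · exact (exc_succ_pos ht m).le

lemma exc_rec (t : ℝ) (m : ℕ) :
    (m + 2 : ℝ) * exc t (m + 2) = t * (2 * (2 * m + 1)) * exc t (m + 1) := by
  have h1 := succ_mul_catalan_eq_centralBinom m
  have h2 := succ_mul_catalan_eq_centralBinom (m + 1)
  have h3 := Nat.succ_mul_centralBinom_succ m
  rw [← h1, ← h2] at h3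
  have h4 : (m + 2 : ℝ) * catalan (m + 1) = 2 * (2 * m + 1) * catalan m := by
    have h5 : (m + 1) * ((m + 2) * catalan (m + 1)) = (m + 1) * (2 * (2 * m + 1) * catalan m) := by
      rw [h3]; ring
    have h6 := Nat.eq_of_mul_eq_mul_left (Nat.succ_pos m) h5
    exact_mod_cast h6
  rw [exc_succ, exc_succ]
  linear_combination t ^ (m + 2) * h4

lemma exc_succ_le {t : ℝ} (ht : 0 < t) (m : ℕ) : exc t (m + 2) ≤ 4 * t * exc t (m + 1) := by
  have h := exc_rec t m
  have h1 := exc_succ_pos ht m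
  have h2 : (m + 2 : ℝ) * exc t (m + 2) ≤ (m + 2 : ℝ) * (4 * t * exc t (m + 1)) := by
    rw [h]
    nlinarith [mul_pos ht h1]
  exact le_of_mul_le_mul_left h2 (by positivity)

/-- The dominating bound for the tail sums in `tendsto_exc_div_stay`. -/
lemma exc_add_le {t : ℝ} (ht : 0 < t) (m i : ℕ) :
    exc t (m + 1 + i) ≤ (4 * t) ^ i * exc t (m + 1) := by
  induction i with
  | zero => simp
  | succ i ih =>
    have := exc_succ_le ht (m + i)
    calc exc t (m + 1 + (i + 1)) = exc t (m + i + 2) := by congr 1; ring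
      _ ≤ 4 * t * exc t (m + i + 1) := this
      _ = 4 * t * exc t (m + 1 + i) := by congr 2; ring
      _ ≤ 4 * t * ((4 * t) ^ i * exc t (m + 1)) := by gcongr
      _ = _ := by ring

lemma tendsto_exc_ratio {t : ℝ} (ht : 0 < t) :
    Tendsto (fun m => exc t (m + 1) / exc t m) atTop (𝓝 (4 * t)) := by
  rw [← tendsto_add_atTop_iff_nat 1]
  have h := (tendsto_add_mul_div_add_mul_atTop_nhds (𝕜 := ℝ) 2 2 4 (d := 1) one_ne_zero).const_mul t
  rw [div_one, mul_comm t] at h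
  refine h.congr fun m => ?_
  have h1 := exc_rec t m
  have h2 := (exc_succ_pos ht m).ne'
  have h3 : (2 + 1 * (m : ℝ)) ≠ 0 := by positivity
  rw [mul_div_assoc', div_eq_div_iff h3 h2]
  linear_combination -h1

lemma tendsto_exc_add_div {t : ℝ} (ht : 0 < t) (i : ℕ) :
    Tendsto (fun m => exc t (m + 1 + i) / exc t (m + 1)) atTop (𝓝 ((4 * t) ^ i)) := by
  induction i with
  | zero =>
    refine tendsto_const_nhds.congr fun m => ?_
    rw [pow_zero, add_zero, div_self (exc_succ_pos ht m).ne']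
  | succ i ih =>
    have h := (tendsto_add_atTop_iff_nat (1 + i)).2 (tendsto_exc_ratio ht)
    rw [pow_succ]
    refine (ih.mul h).congr fun m => ?_
    have h1 := (exc_succ_pos ht m).ne'
    have h2 := (exc_succ_pos ht (m + i)).ne'
    rw [show m + i + 1 = m + 1 + i by ring] at h2
    rw [show m + (1 + i) = m + 1 + i by ring, show m + 1 + i + 1 = m + 1 + (i + 1) by ring]
    field_simp

end Excursions

/-! ### Survival probabilities of the one-dimensional walk and their decay. -/

section Stay

open PowerSeries Topology

variable {P Q : ℝ}

lemma pathWeight_nonneg (hP : 0 ≤ P) (hQ : 0 ≤ Q) (k x r : ℕ) : 0 ≤ pathWeight P Q k x r := by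
  induction k generalizing x r with
  | zero => rw [pathWeight]; split_ifs <;> norm_num
  | succ k ih =>
    rcases x with _ | x
    · rcases r with _ | r
      · rw [pathWeight]
      · rw [pathWeight]; exact mul_nonneg hQ (ih _ _)
    · rw [pathWeight]; exact add_nonneg (mul_nonneg hP (ih _ _)) (mul_nonneg hQ (ih _ _))

lemma stayWeight_nonneg (hP : 0 ≤ P) (hQ : 0 ≤ Q) (k r : ℕ) : 0 ≤ stayWeight P Q k r :=
  Finset.sum_nonneg fun _ _ => pathWeight_nonneg hP hQ _ _ _

lemma stay_zero (P Q : ℝ) : stay P Q 0 = 1 := coeff_zero_stayGF P Q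

lemma stay_succ (P Q : ℝ) (m : ℕ) :
    stay P Q (m + 1) = stay P Q m - P⁻¹ * exc (P * Q) (m + 1) := coeff_succ_stayGF P Q m

/-- Survival probabilities are nonnegative as sums of path weights, and they strictly decrease. -/
lemma stay_pos (hP : 0 < P) (hQ : 0 < Q) (hPQ : P + Q = 1) (m : ℕ) : 0 < stay P Q m := by
  have h1 : 0 ≤ stay P Q (m + 1) := by
    rw [stay, ← sum_stayWeight_even hP.ne' hPQ le_rfl]
    exact Finset.sum_nonneg fun _ _ => stayWeight_nonneg hP.le hQ.le _ _
  rw [stay_succ] at h1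
  have := mul_pos (inv_pos.2 hP) (exc_succ_pos (mul_pos hP hQ) m)
  linarith

lemma stay_eq_one_sub (P Q : ℝ) (m : ℕ) :
    stay P Q m = 1 - P⁻¹ * ∑ j ∈ Finset.range (m + 1), exc (P * Q) j := by
  induction m with
  | zero => simp [stay_zero, exc, excursionGF]
  | succ m ih => rw [stay_succ, ih, Finset.sum_range_succ _ (m + 1)]; ring

lemma sum_exc_le (hP : 0 < P) (hQ : 0 < Q) (hPQ : P + Q = 1) (m : ℕ) :
    ∑ j ∈ Finset.range (m + 1), exc (P * Q) j ≤ P := by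
  have h := stay_pos hP hQ hPQ m
  rw [stay_eq_one_sub, sub_pos, inv_mul_lt_iff₀ hP] at h
  linarith

lemma exc_scale (t : ℝ) (m : ℕ) :
    exc t m = (4 * t) ^ m * exc (1 / 2 * (1 / 2)) m := by
  rcases m with _ | m
  · simp [exc, excursionGF]
  · rw [exc_succ, exc_succ, ← mul_assoc, ← mul_pow]
    congr 2
    ring

lemma stay_conv (hP : P ≠ 0) (hPQ : P + Q = 1) {m : ℕ} (hm : m ≠ 0) :
    Q * stay P Q m
      = ∑ ij ∈ Finset.HasAntidiagonal.antidiagonal m, exc (P * Q) ij.1 * stay P Q ij.2 := by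
  have h := congrArg (coeff m) (excursionGF_mul_stayGF (Q := Q) hP hPQ)
  rw [coeff_mul, coeff_C_mul, map_sub, coeff_one, if_neg hm, sub_zero] at h
  exact h.symm

/-- Induct on the renewal equation `Q U_m = ∑ e_i U_j`. Scaling to the symmetric walk extracts
`(4PQ)^m`, and what remains is a partial sum of symmetric excursion weights, at most `1/2 ≤ Q`. -/
lemma stay_le_pow (hP : 0 < P) (hPQ : P + Q = 1) (hlt : P < Q) (m : ℕ) :
    stay P Q m ≤ (4 * (P * Q)) ^ m := by
  have hQ : 0 < Q := hP.trans hlt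
  have ht : 0 < P * Q := mul_pos hP hQ
  induction m using Nat.strong_induction_on with
  | _ m ih =>
    rcases Nat.eq_zero_or_pos m with rfl | hm
    · simp [stay_zero]
    have h1 : Q * stay P Q m ≤ (4 * (P * Q)) ^ m * (1 / 2) := by
      rw [stay_conv hP.ne' hPQ hm.ne']
      calc ∑ ij ∈ Finset.HasAntidiagonal.antidiagonal m, exc (P * Q) ij.1 * stay P Q ij.2
          ≤ ∑ ij ∈ Finset.HasAntidiagonal.antidiagonal m,
              (4 * (P * Q)) ^ m * exc (1 / 2 * (1 / 2)) ij.1 := by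
            apply Finset.sum_le_sum
            rintro ⟨i, j⟩ hij
            simp only [Finset.HasAntidiagonal.mem_antidiagonal] at hij
            rcases Nat.eq_zero_or_pos i with rfl | hi
            · simp [exc, excursionGF]
            · have := ih j (by omega)
              have h0 := exc_nonneg ht i
              calc exc (P * Q) i * stay P Q j ≤ exc (P * Q) i * (4 * (P * Q)) ^ j := by gcongr
                _ = _ := by rw [exc_scale (P * Q), ← hij, pow_add]; ring
        _ = (4 * (P * Q)) ^ m * ∑ i ∈ Finset.range (m + 1), exc (1 / 2 * (1 / 2)) i := by
            rw [← Finset.mul_sum, Finset.Nat.sum_antidiagonal_eq_sum_range_succ_mk]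
        _ ≤ _ := by
            gcongr
            exact sum_exc_le (by norm_num) (by norm_num) (by norm_num) m
    have h2 : (4 * (P * Q)) ^ m * (1 / 2) ≤ Q * (4 * (P * Q)) ^ m := by
      rw [mul_comm]
      gcongr
      linarith
    exact le_of_mul_le_mul_left (h1.trans h2) hQ

/-- The limit of the ratio of excursion weights to staying probabilities. -/
noncomputable def excRatio (P Q : ℝ) : ℝ := if Q ≤ P then 0 else (Q - P) ^ 2 / (4 * Q)

/-- The exponential rate of decay of the staying probabilities per step. -/
noncomputable def decay (P Q : ℝ) : ℝ := if Q ≤ P then 1 else √(4 * P * Q)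

lemma stay_half (m : ℕ) :
    stay (1 / 2) (1 / 2) (m + 1) = (4 * m + 2) * exc (1 / 2 * (1 / 2)) (m + 1) := by
  induction m with
  | zero => rw [stay_succ, stay_zero, exc_succ]; norm_num
  | succ m ih =>
    have h := exc_rec (1 / 2 * (1 / 2)) m
    rw [stay_succ, ih]
    push_cast
    linear_combination -4 * h

lemma tendsto_exc_zero (hP : 0 < P) (hQ : 0 < Q) (hPQ : P + Q = 1) :
    Tendsto (exc (P * Q)) atTop (𝓝 0) := by
  apply Summable.tendsto_atTop_zero
  apply summable_of_sum_range_le (c := P) (exc_nonneg (mul_pos hP hQ))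
  intro n
  refine le_trans ?_ (sum_exc_le hP hQ hPQ n)
  rw [Finset.sum_range_succ]
  have := exc_nonneg (mul_pos hP hQ) n
  linarith

/-- Three regimes. For `P < Q`, survival is a tail sum of excursion weights, asymptotically
geometric with ratio `4PQ`. For `P = Q`, the closed form `stay_half` exhibits the quotient. For `P >
Q`, survival is bounded below while excursion weights vanish. -/
lemma tendsto_exc_div_stay (hP : 0 < P) (hQ : 0 < Q) (hPQ : P + Q = 1) :
    Tendsto (fun m => exc (P * Q) m / stay P Q m) atTop (𝓝 (excRatio P Q)) := by
  have ht := mul_pos hP hQ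
  rcases lt_trichotomy P Q with hlt | heq | hgt
  · rw [excRatio, if_neg (not_le.2 hlt)]
    have hτ : 4 * (P * Q) < 1 := by nlinarith [mul_pos (sub_pos.2 hlt) (sub_pos.2 hlt)]
    have hU0 : Tendsto (stay P Q) atTop (𝓝 0) :=
      squeeze_zero (fun m => (stay_pos hP hQ hPQ m).le) (stay_le_pow hP hPQ hlt)
        (tendsto_pow_atTop_nhds_zero_of_lt_one (by positivity) hτ)
    -- Survival tends to zero, so it equals the sum of all later losses.
    have hsum : ∀ m, HasSum (fun i => P⁻¹ * exc (P * Q) (m + 1 + (i + 1))) (stay P Q (m + 1)) := by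
      intro m
      rw [hasSum_iff_tendsto_nat_of_nonneg
        (fun i => mul_nonneg (inv_nonneg.2 hP.le) (exc_nonneg ht _))]
      have h1 : ∀ n, ∑ i ∈ Finset.range n, P⁻¹ * exc (P * Q) (m + 1 + (i + 1))
          = stay P Q (m + 1) - stay P Q (n + (m + 1)) := by
        intro n
        induction n with
        | zero => simp
        | succ n ih =>
          have hs := stay_succ P Q (n + (m + 1))
          rw [Finset.sum_range_succ, ih, show n + 1 + (m + 1) = n + (m + 1) + 1 by ring,
            show m + 1 + (n + 1) = n + (m + 1) + 1 by ring]
          linear_combination hs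
      simp only [h1]
      simpa using tendsto_const_nhds.sub ((tendsto_add_atTop_iff_nat (m + 1)).2 hU0)
    have hlim : Tendsto (fun m => ∑' i, P⁻¹ * exc (P * Q) (m + 1 + (i + 1)) / exc (P * Q) (m + 1))
        atTop (𝓝 (∑' i, P⁻¹ * (4 * (P * Q)) ^ (i + 1))) := by
      apply tendsto_tsum_of_dominated_convergence
        (bound := fun i => P⁻¹ * (4 * (P * Q)) ^ (i + 1))
      · apply Summable.mul_left
        exact (summable_nat_add_iff 1).2 (summable_geometric_of_lt_one (by positivity) hτ)
      · intro i
        simp only [mul_div_assoc]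
        exact (tendsto_exc_add_div ht (i + 1)).const_mul _
      · refine Eventually.of_forall fun m i => ?_
        rw [Real.norm_of_nonneg (div_nonneg (mul_nonneg (inv_nonneg.2 hP.le) (exc_nonneg ht _))
          (exc_nonneg ht _)), div_le_iff₀ (exc_succ_pos ht m), mul_assoc]
        exact mul_le_mul_of_nonneg_left (exc_add_le ht m (i + 1)) (inv_nonneg.2 hP.le)
    have hval : ∑' i, P⁻¹ * (4 * (P * Q)) ^ (i + 1) = (4 * Q) / (Q - P) ^ 2 := by
      rw [tsum_mul_left]
      simp only [pow_succ]
      rw [tsum_mul_right, tsum_geometric_of_lt_one (by positivity) hτ]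
      have h1 : 1 - 4 * (P * Q) = (Q - P) ^ 2 := by
        linear_combination (-1 - P - Q) * hPQ
      rw [h1]
      have h2 : Q - P ≠ 0 := by linarith
      field_simp
    rw [hval] at hlim
    rw [← tendsto_add_atTop_iff_nat 1]
    have h3 : (4 * Q) / (Q - P) ^ 2 ≠ 0 := by
      have h2 : Q - P ≠ 0 := by linarith
      positivity
    have h4 := hlim.inv₀ h3
    rw [inv_div] at h4
    refine h4.congr fun m => ?_
    rw [tsum_div_const, (hsum m).tsum_eq, inv_div]
  · subst heq
    obtain rfl : P = 1 / 2 := by linarith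
    rw [excRatio, if_pos le_rfl, ← tendsto_add_atTop_iff_nat 1]
    have h := (tendsto_add_mul_div_add_mul_atTop_nhds (𝕜 := ℝ) 1 2 0 (d := 4) (by norm_num))
    rw [zero_div] at h
    refine h.congr fun m => ?_
    have h1 := (exc_succ_pos ht m).ne'
    rw [stay_half]
    have h2 : (2 + 4 * (m : ℝ)) ≠ 0 := by positivity
    have h3 : (4 * (m : ℝ) + 2) ≠ 0 := by positivity
    rw [div_eq_div_iff h2 (mul_ne_zero h3 h1)]
    ring
  · rw [excRatio, if_pos hgt.le]
    -- Excursion weights depend only on `P * Q`, so the bound for the walk with `P` and `Q`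
    -- exchanged limits their sum by `Q`.
    have hlow : ∀ m, 1 - P⁻¹ * Q ≤ stay P Q m := by
      intro m
      have h := sum_exc_le hQ hP (by linarith) m
      rw [mul_comm Q P] at h
      rw [stay_eq_one_sub]
      gcongr
    have hpos : 0 < 1 - P⁻¹ * Q := by
      rw [sub_pos, inv_mul_lt_iff₀ hP]; linarith
    have h0 := (tendsto_exc_zero hP hQ hPQ).div_const (1 - P⁻¹ * Q)
    rw [zero_div] at h0
    refine squeeze_zero (fun m => div_nonneg (exc_nonneg ht m) (stay_pos hP hQ hPQ m).le)
      (fun m => ?_) h0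
    exact div_le_div_of_nonneg_left (exc_nonneg ht m) hpos (hlow m)

lemma decay_pos (hP : 0 < P) (hQ : 0 < Q) : 0 < decay P Q := by
  rw [decay]
  split_ifs <;> positivity

lemma decay_sq (hP : 0 < P) (hQ : 0 < Q) (hPQ : P + Q = 1) :
    decay P Q ^ 2 = 1 - 4 * Q * excRatio P Q := by
  rw [decay, excRatio]
  split_ifs
  · ring
  · rw [Real.sq_sqrt (by positivity)]
    field_simp
    linear_combination (P + Q + 1) * hPQ

/-- Either the excursion ratio vanishes, or the squared decay rate is exactly `4PQ`. -/
lemma exc_decay (hP : 0 < P) (hQ : 0 < Q) :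
    P * Q / decay P Q ^ 2 * excRatio P Q = excRatio P Q / 4 := by
  rw [decay, excRatio]
  split_ifs
  · ring
  · rw [Real.sq_sqrt (by positivity)]
    field_simp

lemma tendsto_stay_ratio (hP : 0 < P) (hQ : 0 < Q) (hPQ : P + Q = 1) :
    Tendsto (fun m => stay P Q (m + 1) / stay P Q m) atTop (𝓝 (decay P Q ^ 2)) := by
  have h := ((tendsto_exc_ratio (mul_pos hP hQ)).mul (tendsto_exc_div_stay hP hQ hPQ)).const_mul P⁻¹
  have h2 := h.const_sub 1
  have h3 : 1 - P⁻¹ * (4 * (P * Q) * excRatio P Q) = decay P Q ^ 2 := by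
    rw [decay_sq hP hQ hPQ]; field_simp
  rw [h3, ← tendsto_add_atTop_iff_nat 1] at h2
  rw [← tendsto_add_atTop_iff_nat 1]
  refine h2.congr fun m => ?_
  have h4 := (exc_succ_pos (mul_pos hP hQ) m).ne'
  have h5 := (stay_pos hP hQ hPQ (m + 1)).ne'
  rw [stay_succ P Q (m + 1), sub_div, div_self h5, div_mul_div_cancel₀ h4, mul_div_assoc]

end Stay

/-! ### Limit laws of the number of returns at even and odd times. -/

section ReturnLimits

open PowerSeries Topology

variable {P Q : ℝ}

/-- The limit of the ratio of the coefficients of the `r`-th power of the excursion series to the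
staying probabilities. -/
noncomputable def excPowLim (P Q : ℝ) (r : ℕ) : ℝ := r * 2 / 2 ^ r * excRatio P Q

/-- The limit of the ratio of the coefficients of the staying series multiplied by the `r`-th power
of the excursion series to the staying probabilities. -/
noncomputable def stayPowLim (P Q : ℝ) : ℕ → ℝ
  | 0 => 1
  | r + 1 => Q * (stayPowLim P Q r - excPowLim P Q r)

/-- From `e^(r+2) = e^(r+1) - PQ X e^r`, where the shift by `X` costs the inverse squared decay
rate, `exc_decay` gives the limits the recursion `L (r+2) = L (r+1) - L r / 4`. Its characteristic
polynomial has the double root `1/2`, whence the factor `r * 2 / 2 ^ r`. -/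
lemma tendsto_excPow (hP : 0 < P) (hQ : 0 < Q) (hPQ : P + Q = 1) (r : ℕ) :
    Tendsto (fun m => coeff m (excursionGF (P * Q) ^ r) / stay P Q m) atTop
      (𝓝 (excPowLim P Q r)) := by
  induction r using Nat.twoStepInduction with
  | zero =>
    rw [excPowLim, ← tendsto_add_atTop_iff_nat 1]
    refine tendsto_const_nhds.congr fun m => ?_
    rw [pow_zero (excursionGF _), coeff_one, if_neg (by omega)]
    simp
  | one =>
    have h := tendsto_exc_div_stay hP hQ hPQ
    have h1 : excPowLim P Q 1 = excRatio P Q := by rw [excPowLim]; simp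
    rw [h1]
    simpa [exc] using h
  | more r ih0 ih1 =>
    rw [← tendsto_add_atTop_iff_nat 1]
    have h1 := (tendsto_add_atTop_iff_nat 1).2 ih1
    have h2 := (tendsto_stay_ratio hP hQ hPQ).inv₀ (pow_ne_zero 2 (decay_pos hP hQ).ne')
    have h3 := h1.sub ((ih0.mul h2).const_mul (P * Q))
    have h4 : excPowLim P Q (r + 1) - P * Q * (excPowLim P Q r * (decay P Q ^ 2)⁻¹)
        = excPowLim P Q (r + 2) := by
      have h5 := exc_decay hP hQ
      simp only [excPowLim]
      push_cast
      linear_combination (-(r * 2 / 2 ^ r)) * h5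
    rw [h4] at h3
    refine h3.congr fun m => ?_
    have key : excursionGF (P * Q) ^ (r + 2) = excursionGF (P * Q) ^ (r + 1)
        - X * (C (P * Q) * excursionGF (P * Q) ^ r) := by
      linear_combination (-excursionGF (P * Q) ^ r) * excursionGF_eq (P * Q)
    rw [key, map_sub, coeff_succ_X_mul, coeff_C_mul, sub_div, inv_div]
    have h6 := (stay_pos hP hQ hPQ m).ne'
    field_simp

/-- The recursion of `stayPowLim` is `e U = Q (U - 1)` multiplied by `e^r`. -/
lemma tendsto_stayPow (hP : 0 < P) (hQ : 0 < Q) (hPQ : P + Q = 1) (r : ℕ) :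
    Tendsto (fun m => coeff m (excursionGF (P * Q) ^ r * stayGF P Q) / stay P Q m) atTop
      (𝓝 (stayPowLim P Q r)) := by
  induction r with
  | zero =>
    refine tendsto_const_nhds.congr fun m => ?_
    rw [pow_zero, one_mul, stayPowLim]
    exact (div_self (stay_pos hP hQ hPQ m).ne').symm
  | succ r ih =>
    rw [stayPowLim]
    refine ((ih.sub (tendsto_excPow hP hQ hPQ r)).const_mul Q).congr fun m => ?_
    have key : excursionGF (P * Q) ^ (r + 1) * stayGF P Q
        = C Q * (excursionGF (P * Q) ^ r * stayGF P Q - excursionGF (P * Q) ^ r) := by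
      linear_combination excursionGF (P * Q) ^ r * excursionGF_mul_stayGF hP.ne' hPQ
    rw [key, coeff_C_mul, map_sub]
    ring

/-- The limit law of the number of returns at even times. -/
noncomputable def evenLim (P Q : ℝ) (r : ℕ) : ℝ := stayPowLim P Q r - stayPowLim P Q (r + 1)

/-- The limit law of the number of returns at odd times. -/
noncomputable def oddLim (P Q : ℝ) (r : ℕ) : ℝ :=
  stayPowLim P Q r - stayPowLim P Q (r + 1) - (excPowLim P Q r - excPowLim P Q (r + 1))

lemma tendsto_stayWeight_even (hP : 0 < P) (hQ : 0 < Q) (hPQ : P + Q = 1) (r : ℕ) :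
    Tendsto (fun m => stayWeight P Q (2 * m) r / stay P Q m) atTop (𝓝 (evenLim P Q r)) := by
  refine ((tendsto_stayPow hP hQ hPQ r).sub (tendsto_stayPow hP hQ hPQ (r + 1))).congr fun m => ?_
  rw [(stayWeight_even_odd hP.ne' hPQ m r).1, ← sub_div, ← map_sub]
  congr 2
  ring

lemma tendsto_stayWeight_odd (hP : 0 < P) (hQ : 0 < Q) (hPQ : P + Q = 1) (r : ℕ) :
    Tendsto (fun m => stayWeight P Q (2 * m + 1) r / stay P Q (m + 1)) atTop
      (𝓝 (oddLim P Q r)) := by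
  have h := ((tendsto_stayPow hP hQ hPQ r).sub (tendsto_stayPow hP hQ hPQ (r + 1))).sub
    ((tendsto_excPow hP hQ hPQ r).sub (tendsto_excPow hP hQ hPQ (r + 1)))
  refine ((tendsto_add_atTop_iff_nat 1).2 h).congr fun m => ?_
  rw [(stayWeight_even_odd hP.ne' hPQ m r).2, ← sub_div, ← sub_div, ← sub_div, ← map_sub,
    ← map_sub, ← map_sub]
  congr 2
  ring

lemma stayPowLim_of_le (h : Q ≤ P) (r : ℕ) : stayPowLim P Q r = Q ^ r := by
  induction r with
  | zero => rw [stayPowLim, pow_zero]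
  | succ r ih => rw [stayPowLim, ih, excPowLim, excRatio, if_pos h]; ring

lemma stayPowLim_of_lt (hPQ : P + Q = 1) (h : P < Q) (r : ℕ) :
    stayPowLim P Q r = (1 + r * (Q - P)) / 2 ^ r := by
  induction r with
  | zero => rw [stayPowLim]; simp
  | succ r ih =>
    have hQ : Q ≠ 0 := by intro h0; rw [h0] at hPQ h; linarith
    rw [stayPowLim, ih, excPowLim, excRatio, if_neg (not_le.2 h)]
    field_simp
    push_cast
    rw [eq_sub_of_add_eq hPQ]
    ring

lemma evenLim_of_le (hPQ : P + Q = 1) (h : Q ≤ P) (r : ℕ) : evenLim P Q r = (1 - P) ^ r * P := by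
  rw [evenLim, stayPowLim_of_le h, stayPowLim_of_le h, ← eq_sub_of_add_eq' hPQ]
  linear_combination (-Q ^ r) * hPQ

/-- The excursion terms distinguishing the parities vanish here; this is the source of independence.
-/
lemma oddLim_of_le (hPQ : P + Q = 1) (h : Q ≤ P) (r : ℕ) : oddLim P Q r = (1 - P) ^ r * P := by
  rw [oddLim, ← evenLim, evenLim_of_le hPQ h, excPowLim, excPowLim, excRatio, if_pos h]
  ring

lemma evenLim_of_lt {p q : ℝ} (hp : 0 < p) (hpq : p < q) (r : ℕ) :
    evenLim (p / (p + q)) (q / (p + q)) r = phiEven p q r := by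
  have hq : 0 < q := hp.trans hpq
  have h1 : p / (p + q) + q / (p + q) = 1 := by field_simp
  have h2 : p / (p + q) < q / (p + q) := by gcongr
  rw [evenLim, stayPowLim_of_lt h1 h2, stayPowLim_of_lt h1 h2, phiEven]
  field_simp
  push_cast
  ring

lemma oddLim_of_lt {p q : ℝ} (hp : 0 < p) (hpq : p < q) (r : ℕ) :
    oddLim (p / (p + q)) (q / (p + q)) r = phiOdd p q r := by
  have hq : 0 < q := hp.trans hpq
  have h1 : p / (p + q) + q / (p + q) = 1 := by field_simp
  have h2 : p / (p + q) < q / (p + q) := by gcongr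
  rw [oddLim, ← evenLim, evenLim_of_lt hp hpq, phiEven, phiOdd, excPowLim, excPowLim, excRatio,
    if_neg (not_le.2 h2)]
  field_simp
  push_cast
  ring

/-- A sequence with regular ratios to which the weights of the nonnegative paths are compared. -/
noncomputable def stayNorm (P Q : ℝ) (k : ℕ) : ℝ :=
  stay P Q ((k + 1) / 2) * if Even k then 1 else (decay P Q)⁻¹

lemma stayNorm_even (P Q : ℝ) (m : ℕ) : stayNorm P Q (2 * m) = stay P Q m := by
  rw [stayNorm, if_pos (even_two_mul m), mul_one]
  congr 1
  omega

lemma stayNorm_odd (P Q : ℝ) (m : ℕ) :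
    stayNorm P Q (2 * m + 1) = stay P Q (m + 1) * (decay P Q)⁻¹ := by
  rw [stayNorm, if_neg (Nat.not_even_iff_odd.2 (odd_two_mul_add_one m))]
  congr 2
  omega

lemma stayNorm_pos (hP : 0 < P) (hQ : 0 < Q) (hPQ : P + Q = 1) (k : ℕ) : 0 < stayNorm P Q k := by
  have h1 := stay_pos hP hQ hPQ ((k + 1) / 2)
  have h2 := decay_pos hP hQ
  rw [stayNorm]
  split_ifs <;> positivity

lemma tendsto_of_even_of_odd {α : Type*} {f : ℕ → α} {l : Filter α}
    (h0 : Tendsto (fun m => f (2 * m)) atTop l) (h1 : Tendsto (fun m => f (2 * m + 1)) atTop l) :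
    Tendsto f atTop l := by
  intro s hs
  obtain ⟨a, ha⟩ := mem_atTop_sets.1 (h0 hs)
  obtain ⟨b, hb⟩ := mem_atTop_sets.1 (h1 hs)
  refine mem_atTop_sets.2 ⟨2 * (a + b) + 2, fun n hn => ?_⟩
  rcases Nat.even_or_odd' n with ⟨k, rfl | rfl⟩
  · exact ha k (by omega)
  · exact hb k (by omega)

/-- Survival itself is equal at times `2m + 1` and `2m + 2`, so under negative drift its one-step
ratios oscillate. Dividing the odd terms by the decay rate spreads the loss evenly over both steps.
-/
lemma tendsto_stayNorm_ratio (hP : 0 < P) (hQ : 0 < Q) (hPQ : P + Q = 1) :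
    Tendsto (fun k => stayNorm P Q (k + 1) / stayNorm P Q k) atTop (𝓝 (decay P Q)) := by
  have hd := (decay_pos hP hQ).ne'
  apply tendsto_of_even_of_odd
  · have h := (tendsto_stay_ratio hP hQ hPQ).mul_const (decay P Q)⁻¹
    rw [pow_two, mul_inv_cancel_right₀ hd] at h
    refine h.congr fun m => ?_
    rw [stayNorm_even, stayNorm_odd]
    ring
  · refine tendsto_const_nhds.congr fun m => ?_
    rw [stayNorm_odd, show 2 * m + 1 + 1 = 2 * (m + 1) by ring, stayNorm_even]
    have := (stay_pos hP hQ hPQ (m + 1)).ne'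
    field_simp

lemma tendsto_stayWeight_div_stayNorm (hP : 0 < P) (hQ : 0 < Q) (hPQ : P + Q = 1) (r : ℕ) :
    Tendsto (fun k => stayWeight P Q k r / stayNorm P Q k
      - if Even k then evenLim P Q r else decay P Q * oddLim P Q r) atTop (𝓝 0) := by
  apply tendsto_of_even_of_odd
  · have h := (tendsto_stayWeight_even hP hQ hPQ r).sub_const (evenLim P Q r)
    rw [sub_self] at h
    refine h.congr fun m => ?_
    rw [stayNorm_even, if_pos (even_two_mul m)]
  · have h := ((tendsto_stayWeight_odd hP hQ hPQ r).const_mul (decay P Q)).sub_const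
      (decay P Q * oddLim P Q r)
    rw [sub_self] at h
    refine h.congr fun m => ?_
    rw [stayNorm_odd, if_neg (Nat.not_even_iff_odd.2 (odd_two_mul_add_one m))]
    have := (decay_pos hP hQ).ne'
    field_simp

lemma sum_stayWeight (hP : 0 < P) (hQ : 0 < Q) (hPQ : P + Q = 1) {k n : ℕ} (hkn : k ≤ n) :
    ∑ r ∈ Finset.range (n + 1), stayWeight P Q k r
      = stayNorm P Q k * if Even k then 1 else decay P Q := by
  rcases Nat.even_or_odd' k with ⟨m, rfl | rfl⟩
  · rw [sum_stayWeight_even hP.ne' hPQ (by omega), stayNorm_even, if_pos (even_two_mul m), mul_one]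
    rfl
  · rw [sum_stayWeight_odd hP.ne' hPQ (by omega), stayNorm_odd,
      if_neg (Nat.not_even_iff_odd.2 (odd_two_mul_add_one m)),
      inv_mul_cancel_right₀ (decay_pos hP hQ).ne']
    rfl

end ReturnLimits

/-! ### Asymptotics of binomial convolutions and the balance of parities. -/

section BinomialConvolution

open Topology

/-- The binomial convolution `∑ (n choose i) * f i j` over `i + j = n`. -/
def binomConv (n : ℕ) (f : ℕ → ℕ → ℝ) : ℝ :=
  ∑ ij ∈ Finset.HasAntidiagonal.antidiagonal n, (n.choose ij.1 : ℝ) * f ij.1 ij.2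

lemma binomConv_zero (f : ℕ → ℕ → ℝ) : binomConv 0 f = f 0 0 := by simp [binomConv]

lemma binomConv_add (n : ℕ) (f g : ℕ → ℕ → ℝ) :
    binomConv n (fun i j => f i j + g i j) = binomConv n f + binomConv n g := by
  simp only [binomConv, mul_add, Finset.sum_add_distrib]

lemma binomConv_const_mul (n : ℕ) (c : ℝ) (f : ℕ → ℕ → ℝ) :
    binomConv n (fun i j => c * f i j) = c * binomConv n f := by
  simp only [binomConv, Finset.mul_sum]
  exact Finset.sum_congr rfl fun _ _ => by ring

lemma binomConv_sum {ι : Type*} (n : ℕ) (s : Finset ι) (f : ι → ℕ → ℕ → ℝ) :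
    binomConv n (fun i j => ∑ a ∈ s, f a i j) = ∑ a ∈ s, binomConv n (f a) := by
  simp only [binomConv, Finset.mul_sum]
  exact Finset.sum_comm

lemma binomConv_congr {n : ℕ} {f g : ℕ → ℕ → ℝ} (h : ∀ i j, i + j = n → f i j = g i j) :
    binomConv n f = binomConv n g := by
  refine Finset.sum_congr rfl ?_
  rintro ⟨i, j⟩ hij
  rw [h i j (by simpa using hij)]

lemma binomConv_le {n : ℕ} {f g : ℕ → ℕ → ℝ} (h : ∀ i j, i + j = n → f i j ≤ g i j) :
    binomConv n f ≤ binomConv n g := by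
  refine Finset.sum_le_sum ?_
  rintro ⟨i, j⟩ hij
  exact mul_le_mul_of_nonneg_left (h i j (by simpa using hij)) (Nat.cast_nonneg _)

lemma abs_binomConv_le (n : ℕ) (f : ℕ → ℕ → ℝ) :
    |binomConv n f| ≤ binomConv n (fun i j => |f i j|) := by
  refine (Finset.abs_sum_le_sum_abs _ _).trans (le_of_eq (Finset.sum_congr rfl fun ij _ => ?_))
  rw [abs_mul, Nat.abs_cast]

/-- Pascal's rule, matching the choice of the coordinate that makes the last step. -/
lemma binomConv_succ (n : ℕ) (f : ℕ → ℕ → ℝ) :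
    binomConv (n + 1) f = binomConv n (fun i j => f i (j + 1)) + binomConv n (fun i j => f (i + 1) j) := by
  rw [binomConv, Finset.sum_antidiagonal_choose_succ_mul, binomConv, binomConv, add_right_inj]
  refine Finset.sum_congr rfl fun ij hij => ?_
  rw [Nat.choose_symm_of_eq_add (Finset.HasAntidiagonal.mem_antidiagonal.1 hij).symm]

lemma binomConv_swap (n : ℕ) (f : ℕ → ℕ → ℝ) :
    binomConv n (fun i j => f j i) = binomConv n f := by
  rw [binomConv, binomConv, ← Finset.Nat.sum_antidiagonal_swap]
  refine Finset.sum_congr rfl fun ij hij => ?_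
  simp only [Prod.fst_swap, Prod.snd_swap]
  rw [Nat.choose_symm_of_eq_add (Finset.HasAntidiagonal.mem_antidiagonal.1 hij).symm]

lemma le_binomConv {n : ℕ} {f : ℕ → ℕ → ℝ} (hf : ∀ i j, 0 ≤ f i j) {j : ℕ} (hj : j ≤ n) :
    (n.choose j : ℝ) * f j (n - j) ≤ binomConv n f :=
  Finset.single_le_sum
    (f := fun ij : ℕ × ℕ => (n.choose ij.1 : ℝ) * f ij.1 ij.2)
    (fun _ _ => mul_nonneg (Nat.cast_nonneg _) (hf _ _))
    (Finset.HasAntidiagonal.mem_antidiagonal.2 (Nat.add_sub_cancel' hj) : (j, n - j) ∈ _)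

variable {V W : ℕ → ℝ} {a b : ℝ}

lemma binomConv_pos (hV : ∀ k, 0 < V k) (hW : ∀ k, 0 < W k) (n : ℕ) :
    0 < binomConv n (fun i j => V i * W j) := by
  refine lt_of_lt_of_le ?_ (le_binomConv (fun i j => (mul_pos (hV i) (hW j)).le) (Nat.zero_le n))
  have := hV 0
  have := hW (n - 0)
  simp only [Nat.choose_zero_right]
  positivity

/-- A single summand is negligible in a binomial convolution of sequences with regular ratios. -/
lemma tendsto_single_div_binomConv (hV : ∀ k, 0 < V k) (hW : ∀ k, 0 < W k)
    (hWr : Tendsto (fun k => W (k + 1) / W k) atTop (𝓝 b)) (j : ℕ) :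
    Tendsto (fun n => (n.choose j : ℝ) * (V j * W (n - j)) / binomConv n (fun i j => V i * W j))
      atTop (𝓝 0) := by
  rw [← tendsto_add_atTop_iff_nat (j + 1)]
  -- Compare the term at `j` with the term at `j + 1`, which is at most the whole sum; after the
  -- shift of `n` the quotient of binomial coefficients is `(j + 1) / (n + 1)`.
  have h1 : Tendsto (fun n : ℕ => (j + 1 : ℝ) / (n + 1) * (V j / V (j + 1)) * (W (n + 1) / W n))
      atTop (𝓝 0) := by
    have h := (((tendsto_const_div_atTop_nhds_zero_nat (j + 1 : ℝ)).comp
      (tendsto_add_atTop_nat 1)).mul_const (V j / V (j + 1))).mul hWr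
    rw [zero_mul, zero_mul] at h
    refine h.congr fun n => ?_
    simp
  refine squeeze_zero (fun n => ?_) (fun n => ?_) h1
  · exact div_nonneg (mul_nonneg (Nat.cast_nonneg _) (mul_pos (hV _) (hW _)).le)
      (binomConv_pos hV hW _).le
  · have h2 := le_binomConv (n := n + (j + 1)) (j := j + 1)
      (fun i j => (mul_pos (hV i) (hW j)).le) (by omega)
    rw [div_le_iff₀ (binomConv_pos hV hW _)]
    have h3 : (0 : ℝ) ≤ (j + 1 : ℝ) / (n + 1) * (V j / V (j + 1)) * (W (n + 1) / W n) := by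
      have := hV j
      have := hV (j + 1)
      have := hW n
      have := hW (n + 1)
      positivity
    refine le_trans (le_of_eq ?_) (mul_le_mul_of_nonneg_left h2 h3)
    have h4 : ((n + (j + 1)).choose (j + 1) : ℝ) * (j + 1) = (n + (j + 1)).choose j * (n + 1) := by
      have := Nat.choose_succ_right_eq (n + (j + 1)) j
      rw [show n + (j + 1) - j = n + 1 by omega] at this
      exact_mod_cast this
    rw [show n + (j + 1) - j = n + 1 by omega, show n + (j + 1) - (j + 1) = n by omega]
    have := (hV (j + 1)).ne'
    have := (hW n).ne'
    field_simp
    linear_combination (-(V j * W (n + 1))) * h4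

/-- Each of the finitely many indices where `f` is not small contributes a negligible share; the
rest contribute at most a small multiple of the whole. -/
lemma tendsto_binomConv_left (hV : ∀ k, 0 < V k) (hW : ∀ k, 0 < W k)
    (hWr : Tendsto (fun k => W (k + 1) / W k) atTop (𝓝 b)) {f : ℕ → ℝ} (hf0 : ∀ k, 0 ≤ f k)
    (hf : Tendsto f atTop (𝓝 0)) :
    Tendsto (fun n => binomConv n (fun i j => f i * (V i * W j))
      / binomConv n (fun i j => V i * W j)) atTop (𝓝 0) := by
  rw [Metric.tendsto_atTop]
  intro ε hε
  obtain ⟨J, hJ⟩ := (eventually_atTop.1 (hf.eventually (gt_mem_nhds (half_pos hε))))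
  have hsingle : Tendsto (fun n => ∑ k ∈ Finset.range J, f k *
      ((n.choose k : ℝ) * (V k * W (n - k)) / binomConv n (fun i j => V i * W j)))
      atTop (𝓝 0) := by
    have := tendsto_finsetSum (Finset.range J) fun k _ =>
      (tendsto_single_div_binomConv hV hW hWr k).const_mul (f k)
    simpa using this
  obtain ⟨N, hN⟩ := eventually_atTop.1 (hsingle.eventually (gt_mem_nhds (half_pos hε)))
  refine ⟨N + J, fun n hn => ?_⟩
  have hZ := binomConv_pos hV hW n
  have hnn : 0 ≤ binomConv n (fun i j => f i * (V i * W j)) := by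
    refine Finset.sum_nonneg fun ij _ => ?_
    exact mul_nonneg (Nat.cast_nonneg _) (mul_nonneg (hf0 _) (mul_pos (hV _) (hW _)).le)
  rw [Real.dist_eq, sub_zero, abs_of_nonneg (div_nonneg hnn hZ.le)]
  have hle : binomConv n (fun i j => f i * (V i * W j)) ≤
      ∑ k ∈ Finset.range J, f k * ((n.choose k : ℝ) * (V k * W (n - k)))
        + ε / 2 * binomConv n (fun i j => V i * W j) := by
    rw [← binomConv_const_mul]
    unfold binomConv
    rw [Finset.Nat.sum_antidiagonal_eq_sum_range_succ_mk,
      Finset.Nat.sum_antidiagonal_eq_sum_range_succ_mk]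
    have hsub : Finset.range J ⊆ Finset.range n.succ := by
      intro x; simp; omega
    rw [← Finset.sum_sdiff hsub, add_comm]
    refine add_le_add (le_of_eq (Finset.sum_congr rfl fun k _ => by ring)) ?_
    refine le_trans (Finset.sum_le_sum (g := fun k => (n.choose k : ℝ) * (ε / 2 * (V k * W (n - k))))
      fun k hk => ?_) (Finset.sum_le_sum_of_subset_of_nonneg Finset.sdiff_subset fun k _ _ => ?_)
    · have hk' : J ≤ k := by simpa using (Finset.mem_sdiff.1 hk).2
      have := (mul_pos (hV k) (hW (n - k))).le
      have := (hJ k hk').le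
      dsimp only
      gcongr
    · have := (mul_pos (hV k) (hW (n - k))).le
      positivity
  have hlt := hN n (by omega)
  calc binomConv n (fun i j => f i * (V i * W j)) / binomConv n (fun i j => V i * W j)
      ≤ (∑ k ∈ Finset.range J, f k * ((n.choose k : ℝ) * (V k * W (n - k)))
        + ε / 2 * binomConv n (fun i j => V i * W j)) / binomConv n (fun i j => V i * W j) := by
        gcongr
    _ = ∑ k ∈ Finset.range J, f k *
      ((n.choose k : ℝ) * (V k * W (n - k)) / binomConv n (fun i j => V i * W j)) + ε / 2 := by
        rw [add_div, mul_div_cancel_right₀ _ hZ.ne', Finset.sum_div]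
        simp only [mul_div_assoc]
    _ < ε := by linarith

lemma tendsto_binomConv_negligible (hV : ∀ k, 0 < V k) (hW : ∀ k, 0 < W k)
    (hVr : Tendsto (fun k => V (k + 1) / V k) atTop (𝓝 a))
    (hWr : Tendsto (fun k => W (k + 1) / W k) atTop (𝓝 b)) {g : ℕ → ℕ → ℝ} {f₁ f₂ : ℕ → ℝ}
    (h₁ : Tendsto f₁ atTop (𝓝 0)) (h₂ : Tendsto f₂ atTop (𝓝 0))
    (hg : ∀ i j, |g i j| ≤ |f₁ i| + |f₂ j|) :
    Tendsto (fun n => binomConv n (fun i j => g i j * (V i * W j))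
      / binomConv n (fun i j => V i * W j)) atTop (𝓝 0) := by
  have k1 := tendsto_binomConv_left hV hW hWr (fun k => abs_nonneg (f₁ k)) (by simpa using h₁.abs)
  have k2 := tendsto_binomConv_left hW hV hVr (fun k => abs_nonneg (f₂ k)) (by simpa using h₂.abs)
  have k3 := k1.add k2
  rw [add_zero] at k3
  refine squeeze_zero_norm (fun n => ?_) k3
  have hZ := binomConv_pos hV hW n
  have e1 : binomConv n (fun i j => W i * V j) = binomConv n (fun i j => V i * W j) := by
    rw [← binomConv_swap]
    exact binomConv_congr fun i j _ => mul_comm _ _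
  have e2 : binomConv n (fun i j => |f₂ i| * (W i * V j))
      = binomConv n (fun i j => |f₂ j| * (V i * W j)) := by
    rw [← binomConv_swap]
    exact binomConv_congr fun i j _ => by ring
  rw [e1, e2, ← add_div, ← binomConv_add, Real.norm_eq_abs, abs_div, abs_of_pos hZ]
  gcongr
  refine (abs_binomConv_le _ _).trans (binomConv_le fun i j _ => ?_)
  have := mul_pos (hV i) (hW j)
  rw [abs_mul, abs_of_pos this, ← add_mul]
  exact mul_le_mul_of_nonneg_right (hg i j) this.le

lemma tendsto_zero_of_affine_rec {x η : ℕ → ℝ} {θ : ℝ} (hθ : |θ| < 1)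
    (hx : ∀ n, x (n + 1) = θ * x n + η n) (hη : Tendsto η atTop (𝓝 0)) :
    Tendsto x atTop (𝓝 0) := by
  rw [Metric.tendsto_atTop]
  intro ε hε
  -- With this bound on the noise the level `ε / 2` is preserved: `|θ| ε/2 + (1 - |θ|) ε/2 = ε/2`.
  have h1 : 0 < (1 - |θ|) * (ε / 2) := mul_pos (by linarith) (half_pos hε)
  obtain ⟨N, hN⟩ := Metric.tendsto_atTop.1 hη _ h1
  have h2 : ∀ k, |x (N + k)| ≤ |θ| ^ k * |x N| + ε / 2 := by
    intro k
    induction k with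
    | zero => simp [(half_pos hε).le]
    | succ k ih =>
      have h3 := hN (N + k) (by omega)
      rw [Real.dist_eq, sub_zero] at h3
      calc |x (N + k + 1)| ≤ |θ| * |x (N + k)| + |η (N + k)| := by
            rw [hx, ← abs_mul]; exact abs_add_le _ _
        _ ≤ |θ| * (|θ| ^ k * |x N| + ε / 2) + (1 - |θ|) * (ε / 2) := by gcongr
        _ = _ := by ring
  have h4 : Tendsto (fun k => |θ| ^ k * |x N|) atTop (𝓝 0) := by
    simpa using (tendsto_pow_atTop_nhds_zero_of_lt_one (abs_nonneg θ) hθ).mul_const |x N|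
  obtain ⟨K, hK⟩ := eventually_atTop.1 (h4.eventually (gt_mem_nhds (half_pos hε)))
  refine ⟨N + K, fun n hn => ?_⟩
  obtain ⟨k, rfl⟩ := Nat.exists_eq_add_of_le (show N ≤ n by omega)
  rw [Real.dist_eq, sub_zero]
  have := hK k (by omega)
  have := h2 k
  linarith

/-- By Pascal's rule the plain sum is multiplied by about `a + b` at each step and the alternating
one by about `b - a`. Since `|b - a| < a + b`, their quotient contracts to zero. -/
lemma tendsto_binomConv_alternating (ha : 0 < a) (hb : 0 < b)
    (hV : ∀ k, 0 < V k) (hW : ∀ k, 0 < W k)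
    (hVr : Tendsto (fun k => V (k + 1) / V k) atTop (𝓝 a))
    (hWr : Tendsto (fun k => W (k + 1) / W k) atTop (𝓝 b)) :
    Tendsto (fun n => binomConv n (fun i j => (-1) ^ i * (V i * W j))
      / binomConv n (fun i j => V i * W j)) atTop (𝓝 0) := by
  set Z := fun n => binomConv n (fun i j => V i * W j) with hZdef
  set A := fun n => binomConv n (fun i j => (-1) ^ i * (V i * W j)) with hAdef
  have hZ : ∀ n, 0 < Z n := binomConv_pos hV hW
  have hV1 : Tendsto (fun k => V (k + 1) / V k - a) atTop (𝓝 0) := by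
    simpa using hVr.sub_const a
  have hW1 : Tendsto (fun k => W (k + 1) / W k - b) atTop (𝓝 0) := by
    simpa using hWr.sub_const b
  have hr1 := tendsto_binomConv_negligible hV hW hVr hWr
    (g := fun i j => (V (i + 1) / V i - a) + (W (j + 1) / W j - b)) hV1 hW1
    (fun i j => abs_add_le _ _)
  have hr2 := tendsto_binomConv_negligible hV hW hVr hWr
    (g := fun i j => (-1) ^ i * ((W (j + 1) / W j - b) - (V (i + 1) / V i - a))) hV1 hW1
    (fun i j => by
      rw [abs_mul, abs_pow, abs_neg, abs_one, one_pow, one_mul]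
      have h := abs_add_le (W (j + 1) / W j - b) (-(V (i + 1) / V i - a))
      rw [abs_neg, ← sub_eq_add_neg] at h
      linarith)
  set R₁ := fun n => binomConv n
    (fun i j => ((V (i + 1) / V i - a) + (W (j + 1) / W j - b)) * (V i * W j)) with hR₁
  set R₂ := fun n => binomConv n
    (fun i j => ((-1) ^ i * ((W (j + 1) / W j - b) - (V (i + 1) / V i - a))) * (V i * W j))
    with hR₂
  have hZrec : ∀ n, Z (n + 1) = (a + b) * Z n + R₁ n := by
    intro n
    simp only [hZdef, hR₁]
    rw [binomConv_succ, ← binomConv_add, ← binomConv_const_mul, ← binomConv_add]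
    refine binomConv_congr fun i j _ => ?_
    have := (hV i).ne'
    have := (hW j).ne'
    field_simp
    ring
  have hArec : ∀ n, A (n + 1) = (b - a) * A n + R₂ n := by
    intro n
    simp only [hAdef, hR₂]
    rw [binomConv_succ, ← binomConv_add, ← binomConv_const_mul, ← binomConv_add]
    refine binomConv_congr fun i j _ => ?_
    have := (hV i).ne'
    have := (hW j).ne'
    rw [pow_succ]
    field_simp
    ring
  have hbound : ∀ n, |A n / Z n| ≤ 1 := by
    intro n
    rw [abs_div, abs_of_pos (hZ n), div_le_one (hZ n)]
    refine (abs_binomConv_le _ _).trans (binomConv_le fun i j _ => ?_)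
    rw [abs_mul, abs_pow, abs_neg, abs_one, one_pow, one_mul,
      abs_of_pos (mul_pos (hV i) (hW j))]
  have hab : 0 < a + b := add_pos ha hb
  -- The error term contains the next quotient `A (n + 1) / Z (n + 1)` itself; this is harmless
  -- because that quotient is bounded by `1`.
  refine tendsto_zero_of_affine_rec (θ := (b - a) / (a + b))
    (η := fun n => (a + b)⁻¹ * (R₂ n / Z n - A (n + 1) / Z (n + 1) * (R₁ n / Z n))) ?_ ?_ ?_
  · rw [abs_div, abs_of_pos hab, div_lt_one hab, abs_lt]
    constructor <;> linarith
  · intro n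
    have h1 := hArec n
    have h2 := hZrec n
    have h3 := (hZ n).ne'
    have h4 := (hZ (n + 1)).ne'
    change A (n + 1) / Z (n + 1) = (b - a) / (a + b) * (A n / Z n)
      + (a + b)⁻¹ * (R₂ n / Z n - A (n + 1) / Z (n + 1) * (R₁ n / Z n))
    field_simp
    linear_combination Z (n + 1) * h1 - A (n + 1) * h2
  · have h1 : Tendsto (fun n => A (n + 1) / Z (n + 1) * (R₁ n / Z n)) atTop (𝓝 0) := by
      refine squeeze_zero_norm (fun n => ?_) (by simpa using hr1.abs)
      rw [Real.norm_eq_abs, abs_mul]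
      exact mul_le_of_le_one_left (abs_nonneg _) (hbound _)
    simpa using (hr2.sub h1).const_mul (a + b)⁻¹

/-- The limit along the even integers of a binomial convolution of sequences which are
asymptotically proportional to `V` and `W`, with factors depending on the parity. -/
lemma tendsto_binomConv_parity (ha : 0 < a) (hb : 0 < b)
    (hV : ∀ k, 0 < V k) (hW : ∀ k, 0 < W k)
    (hVr : Tendsto (fun k => V (k + 1) / V k) atTop (𝓝 a))
    (hWr : Tendsto (fun k => W (k + 1) / W k) atTop (𝓝 b)) {F G : ℕ → ℝ} {c₀ c₁ d₀ d₁ : ℝ}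
    (hF : Tendsto (fun k => F k / V k - if Even k then c₀ else c₁) atTop (𝓝 0))
    (hG : Tendsto (fun k => G k / W k - if Even k then d₀ else d₁) atTop (𝓝 0)) :
    Tendsto (fun n => binomConv (2 * n) (fun i j => F i * G j)
      / binomConv (2 * n) (fun i j => V i * W j)) atTop (𝓝 ((c₀ * d₀ + c₁ * d₁) / 2)) := by
  set u := fun k => F k / V k - if Even k then c₀ else c₁ with hu
  set v := fun k => G k / W k - if Even k then d₀ else d₁ with hv
  obtain ⟨M, hM⟩ := (hG.norm.isBoundedUnder_le.bddAbove_range)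
  have hM' : ∀ j, |v j| ≤ M := fun j => hM ⟨j, rfl⟩
  -- The difference between the normalized product and the product of parity constants; `v` is
  -- bounded because it converges.
  have hneg := tendsto_binomConv_negligible hV hW hVr hWr
    (g := fun i j => u i * (v j + if Even j then d₀ else d₁) + (if Even i then c₀ else c₁) * v j)
    (f₁ := fun i => (M + (|d₀| + |d₁|)) * u i) (f₂ := fun j => (|c₀| + |c₁|) * v j)
    (by simpa using hF.const_mul _) (by simpa using hG.const_mul _) (fun i j => by
      have hM0 : 0 ≤ M := (abs_nonneg _).trans (hM' 0)
      have hd : |if Even j then d₀ else d₁| ≤ |d₀| + |d₁| := by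
        split_ifs
        · linarith [abs_nonneg d₁]
        · linarith [abs_nonneg d₀]
      have hc : |if Even i then c₀ else c₁| ≤ |c₀| + |c₁| := by
        split_ifs
        · linarith [abs_nonneg c₁]
        · linarith [abs_nonneg c₀]
      refine (abs_add_le _ _).trans (add_le_add ?_ ?_)
      · rw [abs_mul, abs_mul, mul_comm, abs_of_nonneg (by positivity : 0 ≤ M + (|d₀| + |d₁|))]
        gcongr
        exact (abs_add_le _ _).trans (add_le_add (hM' j) hd)
      · rw [abs_mul, abs_mul, abs_of_nonneg (by positivity : 0 ≤ |c₀| + |c₁|)]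
        gcongr)
  have halt := tendsto_binomConv_alternating ha hb hV hW hVr hWr
  have h2 : Tendsto (fun n : ℕ => 2 * n) atTop atTop :=
    tendsto_id.const_mul_atTop' (by norm_num)
  -- For `i + j` even, the product of parity constants is the mean of `c₀ d₀` and `c₁ d₁` plus
  -- `(-1)^i` times half their difference.
  have h3 := (((halt.comp h2).const_mul ((c₀ * d₀ - c₁ * d₁) / 2)).const_add
    ((c₀ * d₀ + c₁ * d₁) / 2)).add (hneg.comp h2)
  rw [mul_zero, add_zero, add_zero] at h3
  refine h3.congr fun n => ?_
  have hZ := (binomConv_pos hV hW (2 * n)).ne'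
  simp only [Function.comp_apply]
  rw [eq_div_iff hZ, add_mul, add_mul, mul_assoc, div_mul_cancel₀ _ hZ, div_mul_cancel₀ _ hZ,
    ← binomConv_const_mul, ← binomConv_const_mul, ← binomConv_add, ← binomConv_add]
  refine binomConv_congr fun i j hij => ?_
  have hp : Even i ↔ Even j := by
    have : Even (i + j) := hij ▸ even_two_mul n
    exact Nat.even_add.1 this
  have h4 := (hV i).ne'
  have h5 := (hW j).ne'
  have h6 : F i = (u i + if Even i then c₀ else c₁) * V i := by
    simp only [hu]; field_simp; ring
  have h7 : G j = (v j + if Even j then d₀ else d₁) * W j := by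
    simp only [hv]; field_simp; ring
  rw [h6, h7]
  by_cases hi : Even i
  · rw [hi.neg_one_pow, if_pos hi, if_pos (hp.1 hi)]
    ring
  · rw [(Nat.not_even_iff_odd.1 hi).neg_one_pow, if_neg hi, if_neg (fun h => hi (hp.2 h))]
    ring

end BinomialConvolution

/-! ### Pathwise events and their decomposition by the last step. -/

section Paths

variable {Ω : Type*} {ξ : ℕ → Ω → Fin 2 → ℤ}

lemma walk_zero (ω : Ω) (i : Fin 2) : walk ξ 0 ω i = 0 := by simp [walk]

lemma walk_succ (n : ℕ) (ω : Ω) (i : Fin 2) : walk ξ (n + 1) ω i = walk ξ n ω i + ξ n ω i := by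
  rw [walk, Finset.sum_range_succ]
  rfl

lemma returns_zero (i : Fin 2) (ω : Ω) : returns ξ i 0 ω = 0 := by simp [returns]

lemma returns_succ (i : Fin 2) (n : ℕ) (ω : Ω) :
    returns ξ i (n + 1) ω = returns ξ i n ω
      + if walk ξ (n + 1) ω i = 0 ∧ walk ξ n ω i ≠ 0 then 1 else 0 := by
  rw [returns, returns, ← Finset.insert_Icc_right_eq_Icc_add_one (by omega), Finset.filter_insert,
    Nat.add_sub_cancel]
  split_ifs with h
  · rw [Finset.card_insert_of_notMem (by simp)]
  · rfl

lemma returns_le (i : Fin 2) (n : ℕ) (ω : Ω) : returns ξ i n ω ≤ n := by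
  refine (Finset.card_filter_le _ _).trans ?_
  simp

lemma mem_survival {n : ℕ} {ω : Ω} :
    ω ∈ survival ξ n ↔ ∀ m ≤ n, ∀ i, 0 ≤ walk ξ m ω i := by
  rw [survival, Set.mem_ofPred_eq, exitTime, ← ENat.add_one_le_iff (by simp), le_iInf₂_iff]
  constructor
  · intro h m hm i
    by_contra! hneg
    -- The exit time ignores time zero, but the walk is at the origin then.
    have hm0 : 1 ≤ m := by
      by_contra! h0
      obtain rfl : m = 0 := by omega
      rw [walk_zero] at hneg
      omega
    have := h m ⟨hm0, i, hneg⟩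
    norm_cast at this
    omega
  · rintro h m ⟨_, i, hi⟩
    have : n < m := by
      by_contra! hmn
      exact absurd (h m hmn i) (not_le.2 hi)
    exact_mod_cast this

lemma mem_survival_succ {n : ℕ} {ω : Ω} :
    ω ∈ survival ξ (n + 1) ↔ ω ∈ survival ξ n ∧ 0 ≤ walk ξ (n + 1) ω 0 ∧ 0 ≤ walk ξ (n + 1) ω 1 := by
  simp only [mem_survival, Fin.forall_fin_two]
  constructor
  · exact fun h => ⟨fun m hm => h m (by omega), h (n + 1) le_rfl⟩
  · rintro ⟨h1, h2⟩ m hm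
    rcases Nat.lt_or_ge n m with h | h
    · obtain rfl : m = n + 1 := by omega
      exact h2
    · exact h1 m h

/-- The event that the walk stays in the quadrant for `n` steps, ends at `(x, y)`, and has `r` and
`s` returns to zero of its coordinates. -/
def pathEvent (ξ : ℕ → Ω → Fin 2 → ℤ) (n x y r s : ℕ) : Set Ω :=
  {ω | ω ∈ survival ξ n ∧ walk ξ n ω 0 = x ∧ walk ξ n ω 1 = y ∧
    returns ξ 0 n ω = r ∧ returns ξ 1 n ω = s}

lemma pathEvent_zero (x y r s : ℕ) :
    pathEvent ξ 0 x y r s = {_ω | x = 0 ∧ y = 0 ∧ r = 0 ∧ s = 0} := by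
  ext ω
  have : ω ∈ survival ξ 0 := mem_survival.2 fun m hm i => by
    rw [Nat.le_zero.1 hm, walk_zero]
  simp only [pathEvent, Set.mem_ofPred_eq, this, walk_zero, returns_zero, true_and]
  grind

lemma mem_pathEvent_succ {n x y r s : ℕ} {ω : Ω} :
    ω ∈ pathEvent ξ (n + 1) x y r s ↔ ω ∈ survival ξ n ∧
      walk ξ n ω 0 + ξ n ω 0 = x ∧ walk ξ n ω 1 + ξ n ω 1 = y ∧
      returns ξ 0 n ω + (if (x : ℤ) = 0 ∧ walk ξ n ω 0 ≠ 0 then 1 else 0) = r ∧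
      returns ξ 1 n ω + (if (y : ℤ) = 0 ∧ walk ξ n ω 1 ≠ 0 then 1 else 0) = s := by
  simp only [pathEvent, Set.mem_ofPred_eq, mem_survival_succ, returns_succ, walk_succ]
  constructor
  · rintro ⟨⟨h1, _, _⟩, h2, h3, h4, h5⟩
    rw [h2] at h4
    rw [h3] at h5
    exact ⟨h1, h2, h3, h4, h5⟩
  · rintro ⟨h1, h2, h3, h4, h5⟩
    rw [h2, h3]
    exact ⟨⟨h1, by omega, by omega⟩, rfl, rfl, h4, h5⟩

lemma walk_nonneg_of_mem_survival {n : ℕ} {ω : Ω} (h : ω ∈ survival ξ n) :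
    0 ≤ walk ξ n ω 0 ∧ 0 ≤ walk ξ n ω 1 :=
  ⟨mem_survival.1 h n le_rfl 0, mem_survival.1 h n le_rfl 1⟩

/-- This and the next four identities fix the last increment and mirror the clauses of `pathWeight`.
-/
lemma pathEvent_up_zero_zero (n y r s : ℕ) :
    pathEvent ξ (n + 1) 0 y r s ∩ {ω | ξ n ω = Pi.single 0 1} = ∅ := by
  ext ω
  simp only [Set.mem_inter_iff, mem_pathEvent_succ, Set.mem_ofPred_eq, Set.mem_empty_iff_false,
    iff_false, not_and]
  intro ⟨h, h1, _⟩ h2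
  have := walk_nonneg_of_mem_survival h
  rw [h2] at h1
  simp at h1
  omega

lemma pathEvent_up_zero (n x y r s : ℕ) :
    pathEvent ξ (n + 1) (x + 1) y r s ∩ {ω | ξ n ω = Pi.single 0 1}
      = pathEvent ξ n x y r s ∩ {ω | ξ n ω = Pi.single 0 1} := by
  ext ω
  simp only [Set.mem_inter_iff, mem_pathEvent_succ, Set.mem_ofPred_eq]
  refine and_congr_left fun h2 => ?_
  simp only [pathEvent, Set.mem_ofPred_eq, h2]
  refine and_congr_right fun h => ?_
  simp
  grind

lemma pathEvent_down_zero (n x y r s : ℕ) :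
    pathEvent ξ (n + 1) (x + 1) y r s ∩ {ω | ξ n ω = Pi.single 0 (-1)}
      = pathEvent ξ n (x + 2) y r s ∩ {ω | ξ n ω = Pi.single 0 (-1)} := by
  ext ω
  simp only [Set.mem_inter_iff, mem_pathEvent_succ, Set.mem_ofPred_eq]
  refine and_congr_left fun h2 => ?_
  simp only [pathEvent, Set.mem_ofPred_eq, h2]
  refine and_congr_right fun h => ?_
  simp
  grind

lemma pathEvent_down_zero_zero (n y s : ℕ) :
    pathEvent ξ (n + 1) 0 y 0 s ∩ {ω | ξ n ω = Pi.single 0 (-1)} = ∅ := by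
  ext ω
  simp only [Set.mem_inter_iff, mem_pathEvent_succ, Set.mem_ofPred_eq, Set.mem_empty_iff_false,
    iff_false, not_and]
  intro ⟨h, h1, _, h3, _⟩ h2
  rw [h2] at h1
  simp at h1 h3
  grind

lemma pathEvent_return_zero (n y r s : ℕ) :
    pathEvent ξ (n + 1) 0 y (r + 1) s ∩ {ω | ξ n ω = Pi.single 0 (-1)}
      = pathEvent ξ n 1 y r s ∩ {ω | ξ n ω = Pi.single 0 (-1)} := by
  ext ω
  simp only [Set.mem_inter_iff, mem_pathEvent_succ, Set.mem_ofPred_eq]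
  refine and_congr_left fun h2 => ?_
  simp only [pathEvent, Set.mem_ofPred_eq, h2]
  refine and_congr_right fun h => ?_
  simp
  grind

/-- The increments with the two coordinates exchanged. -/
def swapped (ξ : ℕ → Ω → Fin 2 → ℤ) (n : ℕ) (ω : Ω) (i : Fin 2) : ℤ := ξ n ω (1 - i)

lemma walk_swapped (n : ℕ) (ω : Ω) (i : Fin 2) : walk (swapped ξ) n ω i = walk ξ n ω (1 - i) := by
  simp [walk, swapped]

lemma survival_swapped (n : ℕ) : survival (swapped ξ) n = survival ξ n := by
  ext ω
  simp only [mem_survival, walk_swapped, Fin.forall_fin_two]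
  exact forall₂_congr fun m _ => and_comm

lemma returns_swapped (i : Fin 2) (n : ℕ) (ω : Ω) :
    returns (swapped ξ) i n ω = returns ξ (1 - i) n ω := by
  simp only [returns, walk_swapped]

lemma pathEvent_swapped (n x y r s : ℕ) :
    pathEvent (swapped ξ) n y x s r = pathEvent ξ n x y r s := by
  ext ω
  simp only [pathEvent, Set.mem_ofPred_eq, survival_swapped, walk_swapped, returns_swapped,
    sub_zero, sub_self]
  tauto

lemma swapped_eq_single (n : ℕ) (ω : Ω) (c : ℤ) :
    swapped ξ n ω = Pi.single 0 c ↔ ξ n ω = Pi.single 1 c := by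
  simp [funext_iff, Fin.forall_fin_two, swapped, and_comm]

lemma walk_congr {n : ℕ} {ω ω' : Ω} (h : ∀ k < n, ξ k ω = ξ k ω') {m : ℕ} (hm : m ≤ n) :
    walk ξ m ω = walk ξ m ω' :=
  Finset.sum_congr rfl fun k hk => h k (by have := Finset.mem_range.1 hk; omega)

lemma mem_pathEvent_congr {n : ℕ} {ω ω' : Ω} (h : ∀ k < n, ξ k ω = ξ k ω') (x y r s : ℕ)
    (hω : ω ∈ pathEvent ξ n x y r s) : ω' ∈ pathEvent ξ n x y r s := by
  have hret : ∀ i, returns ξ i n ω' = returns ξ i n ω := by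
    intro i
    rw [returns, returns]
    congr 1
    refine Finset.filter_congr fun k hk => ?_
    have := Finset.mem_Icc.1 hk
    rw [walk_congr h this.2, walk_congr h (m := k - 1) (by omega)]
  obtain ⟨h1, h2⟩ := hω
  refine ⟨mem_survival.2 fun m hm i => ?_, ?_⟩
  · rw [← walk_congr h hm]
    exact mem_survival.1 h1 m hm i
  · rwa [hret, hret, ← walk_congr h le_rfl]

/-- Factoring through the discrete space of the first `n` increments yields both measurability and
independence from the next increment. -/
lemma exists_pathEvent_eq_preimage (ξ : ℕ → Ω → Fin 2 → ℤ) (n x y r s : ℕ) :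
    ∃ S : Set (Finset.range n → Fin 2 → ℤ),
      pathEvent ξ n x y r s = (fun ω (k : Finset.range n) => ξ k ω) ⁻¹' S := by
  refine ⟨(fun ω (k : Finset.range n) => ξ k ω) '' pathEvent ξ n x y r s, ?_⟩
  refine Set.Subset.antisymm (Set.subset_preimage_image _ _) ?_
  rintro ω ⟨ω', hω', heq⟩
  exact mem_pathEvent_congr (fun k hk => congrFun heq ⟨k, Finset.mem_range.2 hk⟩) x y r s hω'

end Paths

/-! ### Measurability and independence of path events. -/

section PathProbability

variable {Ω : Type*} [MeasurableSpace Ω] {P : Measure Ω} {ξ : ℕ → Ω → Fin 2 → ℤ}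

lemma measurableSet_pathEvent (hmeas : ∀ k, Measurable (ξ k)) (n x y r s : ℕ) :
    MeasurableSet (pathEvent ξ n x y r s) := by
  obtain ⟨S, hS⟩ := exists_pathEvent_eq_preimage ξ n x y r s
  rw [hS]
  have h : Measurable fun ω (k : Finset.range n) => ξ k ω :=
    measurable_pi_lambda _ fun k => hmeas k
  exact h MeasurableSet.of_discrete

lemma measureReal_pathEvent_inter (hmeas : ∀ k, Measurable (ξ k)) (hindep : iIndepFun ξ P)
    (n x y r s : ℕ) (v : Fin 2 → ℤ) :
    P.real (pathEvent ξ n x y r s ∩ {ω | ξ n ω = v})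
      = P.real (pathEvent ξ n x y r s) * P.real {ω | ξ n ω = v} := by
  obtain ⟨S, hS⟩ := exists_pathEvent_eq_preimage ξ n x y r s
  have h := hindep.indepFun_finset (Finset.range n) {n} (by simp) hmeas
  have h2 := h.measure_inter_preimage_eq_mul S
    {t | t ⟨n, Finset.mem_singleton_self n⟩ = v} .of_discrete .of_discrete
  rw [hS, measureReal_def, measureReal_def, measureReal_def, ← ENNReal.toReal_mul]
  exact congrArg ENNReal.toReal h2

end PathProbability

/-! ### Bounds from the four admissible steps. -/

section Steps

variable {Ω : Type*} {ξ : ℕ → Ω → Fin 2 → ℤ}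

lemma disjoint_step (k : ℕ) {v w : Fin 2 → ℤ} (h : v ≠ w) :
    Disjoint {ω | ξ k ω = v} {ω | ξ k ω = w} := by
  rw [Set.disjoint_left]
  intro ω h1 h2
  exact h (h1.symm.trans h2)

/-- The event that the walk stays in the quadrant for `n` steps with `r` and `s` returns to zero of
its coordinates. -/
def returnEvent (ξ : ℕ → Ω → Fin 2 → ℤ) (n r s : ℕ) : Set Ω :=
  {ω | ω ∈ survival ξ n ∧ returns ξ 0 n ω = r ∧ returns ξ 1 n ω = s}

lemma abs_walk_le {ω : Ω} (h : ∀ k, ω ∈ {ω | ξ k ω = Pi.single 0 1} ∪ {ω | ξ k ω = Pi.single 0 (-1)}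
      ∪ ({ω | ξ k ω = Pi.single 1 1} ∪ {ω | ξ k ω = Pi.single 1 (-1)})) (n : ℕ) :
    walk ξ n ω 0 ≤ n ∧ walk ξ n ω 1 ≤ n := by
  induction n with
  | zero => simp [walk_zero]
  | succ n ih =>
    rw [walk_succ, walk_succ]
    push_cast
    rcases h n with (h | h) | (h | h) <;>
    · rw [Set.mem_ofPred_eq] at h
      rw [h]
      simp
      omega

end Steps

/-! ### Probabilities of path events as binomial convolutions. -/

section PathProbability

variable {Ω : Type*} [MeasurableSpace Ω] {P : Measure Ω} {ξ : ℕ → Ω → Fin 2 → ℤ}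

lemma swapped_measurable (hmeas : ∀ k, Measurable (ξ k)) (k : ℕ) : Measurable (swapped ξ k) :=
  measurable_pi_lambda _ fun i => (measurable_pi_apply (1 - i)).comp (hmeas k)

lemma swapped_iIndepFun (hindep : iIndepFun ξ P) : iIndepFun (swapped ξ) P :=
  hindep.comp (fun _ (v : Fin 2 → ℤ) (i : Fin 2) => v (1 - i)) fun _ =>
    measurable_pi_lambda _ fun i => measurable_pi_apply (1 - i)

/-- The contribution of the steps of the first coordinate to the probabilities of path events. -/
lemma measureReal_pathEvent_step_zero (hmeas : ∀ k, Measurable (ξ k)) (hindep : iIndepFun ξ P)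
    {p q : ℝ} {n : ℕ} (hp : P.real {ω | ξ n ω = Pi.single 0 1} = p)
    (hq : P.real {ω | ξ n ω = Pi.single 0 (-1)} = q) {g : ℕ → ℕ → ℕ → ℝ}
    (ih : ∀ x y r s, P.real (pathEvent ξ n x y r s)
      = binomConv n fun i j => pathWeight p q i x r * g j y s) (x y r s : ℕ) :
    P.real (pathEvent ξ (n + 1) x y r s ∩ {ω | ξ n ω = Pi.single 0 1})
      + P.real (pathEvent ξ (n + 1) x y r s ∩ {ω | ξ n ω = Pi.single 0 (-1)})
      = binomConv n fun i j => pathWeight p q (i + 1) x r * g j y s := by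
  rcases x with _ | x
  · rw [pathEvent_up_zero_zero, measureReal_empty, zero_add]
    rcases r with _ | r
    · rw [pathEvent_down_zero_zero, measureReal_empty]
      simp [binomConv, pathWeight]
    · rw [pathEvent_return_zero, measureReal_pathEvent_inter hmeas hindep, ih, hq, mul_comm,
        ← binomConv_const_mul]
      refine binomConv_congr fun i j _ => ?_
      rw [pathWeight]
      ring
  · rw [pathEvent_up_zero, pathEvent_down_zero, measureReal_pathEvent_inter hmeas hindep,
      measureReal_pathEvent_inter hmeas hindep, ih, ih, hp, hq, mul_comm _ p, mul_comm _ q,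
      ← binomConv_const_mul, ← binomConv_const_mul, ← binomConv_add]
    refine binomConv_congr fun i j _ => ?_
    rw [pathWeight]
    ring

variable [IsProbabilityMeasure P]

lemma measurableSet_step (hmeas : ∀ k, Measurable (ξ k)) (k : ℕ) (v : Fin 2 → ℤ) :
    MeasurableSet {ω | ξ k ω = v} := hmeas k (measurableSet_singleton v)

lemma measureReal_step_split (hmeas : ∀ k, Measurable (ξ k)) (k : ℕ) (E : Set Ω) (hE : MeasurableSet E) :
    P.real (E ∩ ({ω | ξ k ω = Pi.single 0 1} ∪ {ω | ξ k ω = Pi.single 0 (-1)}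
      ∪ ({ω | ξ k ω = Pi.single 1 1} ∪ {ω | ξ k ω = Pi.single 1 (-1)})))
    = P.real (E ∩ {ω | ξ k ω = Pi.single 0 1}) + P.real (E ∩ {ω | ξ k ω = Pi.single 0 (-1)})
      + (P.real (E ∩ {ω | ξ k ω = Pi.single 1 1})
        + P.real (E ∩ {ω | ξ k ω = Pi.single 1 (-1)})) := by
  have hm : ∀ v, MeasurableSet (E ∩ {ω | ξ k ω = v}) :=
    fun v => hE.inter (measurableSet_step hmeas k v)
  have hd : ∀ {v w : Fin 2 → ℤ}, v ≠ w → Disjoint (E ∩ {ω | ξ k ω = v}) (E ∩ {ω | ξ k ω = w}) :=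
    fun h => (disjoint_step k h).mono Set.inter_subset_right Set.inter_subset_right
  rw [Set.inter_union_distrib_left, Set.inter_union_distrib_left, Set.inter_union_distrib_left,
    measureReal_union, measureReal_union, measureReal_union]
  · exact hd (by decide)
  · exact hm _
  · exact hd (by decide)
  · exact hm _
  · rw [Set.disjoint_union_left, Set.disjoint_union_right, Set.disjoint_union_right]
    exact ⟨⟨hd (by decide), hd (by decide)⟩, ⟨hd (by decide), hd (by decide)⟩⟩
  · exact (hm _).union (hm _)

variable {p q : Fin 2 → ℝ}

/-- The four disjoint step events have total probability one. -/
lemma ae_step (hsum : ∑ i, (p i + q i) = 1) (hmeas : ∀ k, Measurable (ξ k))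
    (hpos : ∀ k i, P.real {ω | ξ k ω = Pi.single i 1} = p i)
    (hneg : ∀ k i, P.real {ω | ξ k ω = Pi.single i (-1)} = q i) (k : ℕ) :
    ∀ᵐ ω ∂P, ω ∈ {ω | ξ k ω = Pi.single 0 1} ∪ {ω | ξ k ω = Pi.single 0 (-1)}
      ∪ ({ω | ξ k ω = Pi.single 1 1} ∪ {ω | ξ k ω = Pi.single 1 (-1)}) := by
  have hm := measurableSet_step hmeas k
  have h := measureReal_step_split (P := P) hmeas k Set.univ .univ
  simp only [Set.univ_inter, hpos, hneg] at h
  rw [Fin.sum_univ_two] at hsum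
  rw [hsum] at h
  rw [measureReal_def, ENNReal.toReal_eq_one_iff] at h
  exact (prob_compl_eq_zero_iff (((hm _).union (hm _)).union ((hm _).union (hm _)))).2 h

/-- Induction on `n`: a last step in either coordinate produces one of the two terms of
`binomConv_succ`, the second coordinate being handled by exchanging coordinates. -/
theorem measureReal_pathEvent (hsum : ∑ i, (p i + q i) = 1) (hmeas : ∀ k, Measurable (ξ k))
    (hindep : iIndepFun ξ P) (hpos : ∀ k i, P.real {ω | ξ k ω = Pi.single i 1} = p i)
    (hneg : ∀ k i, P.real {ω | ξ k ω = Pi.single i (-1)} = q i) (n x y r s : ℕ) :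
    P.real (pathEvent ξ n x y r s) = binomConv n
      fun i j => pathWeight (p 0) (q 0) i x r * pathWeight (p 1) (q 1) j y s := by
  induction n generalizing x y r s with
  | zero =>
    rw [pathEvent_zero, binomConv_zero, pathWeight, pathWeight]
    by_cases h : x = 0 ∧ y = 0 ∧ r = 0 ∧ s = 0
    · simp [h]
    · have h' : ¬ ((x = 0 ∧ r = 0) ∧ (y = 0 ∧ s = 0)) := by tauto
      simp only [h, Set.ofPred_false, measureReal_empty]
      split_ifs <;> simp_all
  | succ n ih =>
    have h1 := measureReal_pathEvent_step_zero hmeas hindep (hpos n 0) (hneg n 0)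
      (g := pathWeight (p 1) (q 1)) ih x y r s
    have h2 := measureReal_pathEvent_step_zero (swapped_measurable hmeas)
      (swapped_iIndepFun hindep) (n := n) (p := p 1) (q := q 1)
      (by simp only [swapped_eq_single, hpos]) (by simp only [swapped_eq_single, hneg])
      (g := pathWeight (p 0) (q 0)) (fun y x s r => by
        rw [pathEvent_swapped, ih, ← binomConv_swap]
        exact binomConv_congr fun i j _ => mul_comm _ _) y x s r
    simp only [swapped_eq_single, pathEvent_swapped] at h2
    have h3 : P.real (pathEvent ξ (n + 1) x y r s) = P.real (pathEvent ξ (n + 1) x y r s ∩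
        ({ω | ξ n ω = Pi.single 0 1} ∪ {ω | ξ n ω = Pi.single 0 (-1)}
      ∪ ({ω | ξ n ω = Pi.single 1 1} ∪ {ω | ξ n ω = Pi.single 1 (-1)}))) := by
      apply measureReal_congr
      filter_upwards [ae_step hsum hmeas hpos hneg n] with ω hω
      exact propext ⟨fun h => ⟨h, hω⟩, fun h => h.1⟩
    rw [h3, measureReal_step_split hmeas n _ (measurableSet_pathEvent hmeas _ _ _ _ _), h1, h2,
      binomConv_succ, ← binomConv_swap n fun i j =>
        pathWeight (p 0) (q 0) i x r * pathWeight (p 1) (q 1) (j + 1) y s, add_comm]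
    congr 1
    exact binomConv_congr fun i j _ => mul_comm _ _

theorem measureReal_returnEvent (hsum : ∑ i, (p i + q i) = 1) (hmeas : ∀ k, Measurable (ξ k))
    (hindep : iIndepFun ξ P) (hpos : ∀ k i, P.real {ω | ξ k ω = Pi.single i 1} = p i)
    (hneg : ∀ k i, P.real {ω | ξ k ω = Pi.single i (-1)} = q i) (n r s : ℕ) :
    P.real (returnEvent ξ n r s) = binomConv n
      fun i j => stayWeight (p 0) (q 0) i r * stayWeight (p 1) (q 1) j s := by
  -- Almost surely each coordinate is at most `n` after `n` steps, so finitely many endpoints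
  -- suffice.
  have h1 : P.real (returnEvent ξ n r s) = P.real (⋃ xy ∈ Finset.range (n + 1) ×ˢ
      Finset.range (n + 1), pathEvent ξ n xy.1 xy.2 r s) := by
    apply measureReal_congr
    filter_upwards [ae_all_iff.2 (ae_step hsum hmeas hpos hneg)] with ω hω
    have hle := abs_walk_le hω n
    apply propext
    change ω ∈ returnEvent ξ n r s ↔ ω ∈ ⋃ xy ∈ Finset.range (n + 1) ×ˢ
      Finset.range (n + 1), pathEvent ξ n xy.1 xy.2 r s
    simp only [Set.mem_iUnion, exists_prop, Finset.mem_product, Finset.mem_range]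
    constructor
    · rintro ⟨h1, h2⟩
      have := walk_nonneg_of_mem_survival h1
      refine ⟨((walk ξ n ω 0).toNat, (walk ξ n ω 1).toNat), by omega, h1, ?_, ?_, h2⟩ <;>
      · simp only; omega
    · rintro ⟨_, _, h1, _, _, h2⟩
      exact ⟨h1, h2⟩
  rw [h1, measureReal_biUnion_finset _ fun _ _ => measurableSet_pathEvent hmeas _ _ _ _ _,
    Finset.sum_product]
  · simp only [measureReal_pathEvent hsum hmeas hindep hpos hneg, ← binomConv_sum]
    refine binomConv_congr fun i j hij => ?_
    rw [← sum_range_pathWeight (show i ≤ n by omega), ← sum_range_pathWeight (show j ≤ n by omega),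
      Finset.sum_mul_sum]
  · rintro ⟨x, y⟩ _ ⟨x', y'⟩ _ hne
    refine Set.disjoint_left.2 fun ω h h' => hne ?_
    obtain ⟨_, h1, h2, _⟩ := h
    obtain ⟨_, h3, h4, _⟩ := h'
    rw [h1] at h3
    rw [h2] at h4
    simp only at h3 h4
    exact Prod.ext (by exact_mod_cast h3) (by exact_mod_cast h4)

lemma measurableSet_survival (hmeas : ∀ k, Measurable (ξ k)) (n : ℕ) :
    MeasurableSet (survival ξ n) := by
  have h : survival ξ n = ⋂ m ∈ Finset.range (n + 1), ⋂ i, {ω | 0 ≤ walk ξ m ω i} := by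
    ext ω
    simp [mem_survival]
  rw [h]
  refine Finset.measurableSet_biInter _ fun m _ => MeasurableSet.iInter fun i => ?_
  have hw : Measurable fun ω => walk ξ m ω i := by
    simp only [walk, Finset.sum_apply]
    exact Finset.measurable_fun_sum _ fun k _ => (measurable_pi_apply i).comp (hmeas k)
  exact measurableSet_le measurable_const hw

lemma measurable_returns (hmeas : ∀ k, Measurable (ξ k)) (i : Fin 2) (n : ℕ) :
    Measurable (returns ξ i n) := by
  have hw : ∀ m, Measurable fun ω => walk ξ m ω i := fun m => by
    simp only [walk, Finset.sum_apply]
    exact Finset.measurable_fun_sum _ fun k _ => (measurable_pi_apply i).comp (hmeas k)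
  induction n with
  | zero =>
    have : returns ξ i 0 = fun _ => 0 := funext (returns_zero i)
    rw [this]
    exact measurable_const
  | succ n ih =>
    have : returns ξ i (n + 1) = fun ω => returns ξ i n ω
        + if walk ξ (n + 1) ω i = 0 ∧ walk ξ n ω i ≠ 0 then 1 else 0 :=
      funext (returns_succ i n)
    rw [this]
    refine ih.add (Measurable.ite ?_ measurable_const measurable_const)
    exact (measurableSet_eq_fun (hw _) measurable_const).inter
      (measurableSet_eq_fun (hw _) measurable_const).compl

lemma measurableSet_returnEvent (hmeas : ∀ k, Measurable (ξ k)) (n r s : ℕ) :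
    MeasurableSet (returnEvent ξ n r s) :=
  (measurableSet_survival hmeas n).inter
    ((measurable_returns hmeas 0 n (measurableSet_singleton r)).inter
      (measurable_returns hmeas 1 n (measurableSet_singleton s)))

theorem measureReal_survival (hsum : ∑ i, (p i + q i) = 1) (hmeas : ∀ k, Measurable (ξ k))
    (hindep : iIndepFun ξ P) (hpos : ∀ k i, P.real {ω | ξ k ω = Pi.single i 1} = p i)
    (hneg : ∀ k i, P.real {ω | ξ k ω = Pi.single i (-1)} = q i) (n : ℕ) :
    P.real (survival ξ n) = binomConv n
      fun i j => (∑ r ∈ Finset.range (n + 1), stayWeight (p 0) (q 0) i r)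
        * ∑ s ∈ Finset.range (n + 1), stayWeight (p 1) (q 1) j s := by
  have h1 : survival ξ n = ⋃ rs ∈ Finset.range (n + 1) ×ˢ Finset.range (n + 1),
      returnEvent ξ n rs.1 rs.2 := by
    ext ω
    simp only [Set.mem_iUnion, exists_prop, Finset.mem_product, Finset.mem_range]
    constructor
    · intro h
      have := returns_le (ξ := ξ) 0 n ω
      have := returns_le (ξ := ξ) 1 n ω
      exact ⟨(returns ξ 0 n ω, returns ξ 1 n ω), by omega, h, rfl, rfl⟩
    · rintro ⟨_, _, h, _⟩
      exact h
  rw [h1, measureReal_biUnion_finset _ fun _ _ => measurableSet_returnEvent hmeas _ _ _,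
    Finset.sum_product]
  · simp only [measureReal_returnEvent hsum hmeas hindep hpos hneg, ← binomConv_sum,
      Finset.sum_mul_sum]
  · rintro ⟨x, y⟩ _ ⟨x', y'⟩ _ hne
    refine Set.disjoint_left.2 fun ω h h' => hne ?_
    exact Prod.ext (h.2.1.symm.trans h'.2.1) (h.2.2.symm.trans h'.2.2)

end PathProbability

/-! ### Limits of the conditional point masses. -/

section MassLimits

open Topology

/-- Weights are homogeneous in the number of steps, which reduces general step probabilities to the
case `P + Q = 1`. -/
lemma pathWeight_smul (c P Q : ℝ) (k x r : ℕ) :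
    pathWeight (c * P) (c * Q) k x r = c ^ k * pathWeight P Q k x r := by
  induction k generalizing x r with
  | zero => rw [pathWeight, pathWeight, pow_zero, one_mul]
  | succ k ih =>
    rcases x with _ | x
    · rcases r with _ | r
      · rw [pathWeight, pathWeight, mul_zero]
      · rw [pathWeight, pathWeight, ih]; ring
    · rw [pathWeight, pathWeight, ih, ih]; ring

lemma stayWeight_smul (c P Q : ℝ) (k r : ℕ) :
    stayWeight (c * P) (c * Q) k r = c ^ k * stayWeight P Q k r := by
  simp only [stayWeight, pathWeight_smul, Finset.mul_sum]

variable {p q : ℝ}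

lemma stayWeight_eq_normalized (hp : 0 < p) (hq : 0 < q) (k r : ℕ) :
    stayWeight p q k r = (p + q) ^ k * stayWeight (p / (p + q)) (q / (p + q)) k r := by
  rw [← stayWeight_smul, mul_div_cancel₀ _ (by positivity), mul_div_cancel₀ _ (by positivity)]

lemma normalized_add (hp : 0 < p) (hq : 0 < q) : p / (p + q) + q / (p + q) = 1 := by
  field_simp

/-- The comparison sequence for general step weights. -/
noncomputable def weightNorm (p q : ℝ) (k : ℕ) : ℝ :=
  (p + q) ^ k * stayNorm (p / (p + q)) (q / (p + q)) k

/-- The decay rate per step relative to the probability of a step. -/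
noncomputable def rate (p q : ℝ) : ℝ := decay (p / (p + q)) (q / (p + q))

lemma rate_pos (hp : 0 < p) (hq : 0 < q) : 0 < rate p q := decay_pos (by positivity) (by positivity)

lemma rate_of_le (hp : 0 < p) (hq : 0 < q) (h : q ≤ p) : rate p q = 1 := by
  rw [rate, decay, if_pos (by gcongr)]

lemma rate_of_lt (hp : 0 < p) (h : p < q) : rate p q = rho p q := by
  have hq : 0 < q := hp.trans h
  rw [rate, decay, if_neg (not_le.2 (by gcongr)), rho,
    show 4 * (p / (p + q)) * (q / (p + q)) = 4 * p * q / (p + q) ^ 2 by field_simp,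
    Real.sqrt_div (by positivity), Real.sqrt_sq (by positivity)]

lemma weightNorm_pos (hp : 0 < p) (hq : 0 < q) (k : ℕ) : 0 < weightNorm p q k :=
  mul_pos (by positivity)
    (stayNorm_pos (by positivity) (by positivity) (normalized_add hp hq) k)

lemma tendsto_weightNorm_ratio (hp : 0 < p) (hq : 0 < q) :
    Tendsto (fun k => weightNorm p q (k + 1) / weightNorm p q k) atTop
      (𝓝 ((p + q) * rate p q)) := by
  have h := (tendsto_stayNorm_ratio (P := p / (p + q)) (Q := q / (p + q)) (by positivity)
    (by positivity) (normalized_add hp hq)).const_mul (p + q)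
  refine h.congr fun k => ?_
  rw [weightNorm, weightNorm, pow_succ, mul_assoc,
    mul_div_mul_left _ _ (pow_ne_zero k (by positivity)), mul_div_assoc]

lemma tendsto_stayWeight_div_weightNorm (hp : 0 < p) (hq : 0 < q) (r : ℕ) :
    Tendsto (fun k => stayWeight p q k r / weightNorm p q k
      - if Even k then evenLim (p / (p + q)) (q / (p + q)) r
        else rate p q * oddLim (p / (p + q)) (q / (p + q)) r) atTop (𝓝 0) := by
  refine (tendsto_stayWeight_div_stayNorm (P := p / (p + q)) (Q := q / (p + q)) (by positivity)
    (by positivity) (normalized_add hp hq) r).congr fun k => ?_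
  rw [stayWeight_eq_normalized hp hq, weightNorm,
    mul_div_mul_left _ _ (pow_ne_zero k (by positivity))]
  rfl

lemma sum_stayWeight_eq_weightNorm (hp : 0 < p) (hq : 0 < q) {k n : ℕ} (h : k ≤ n) :
    ∑ r ∈ Finset.range (n + 1), stayWeight p q k r
      = weightNorm p q k * if Even k then 1 else rate p q := by
  simp only [stayWeight_eq_normalized hp hq]
  rw [← Finset.mul_sum, sum_stayWeight (by positivity) (by positivity) (normalized_add hp hq) h,
    weightNorm, mul_assoc]
  rfl

variable {Ω : Type*} [MeasurableSpace Ω] {P : Measure Ω} [IsProbabilityMeasure P]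
  {ξ : ℕ → Ω → Fin 2 → ℤ} {p q : Fin 2 → ℝ}

theorem measureReal_survival_eq (hp : ∀ i, 0 < p i) (hq : ∀ i, 0 < q i)
    (hsum : ∑ i, (p i + q i) = 1) (hmeas : ∀ k, Measurable (ξ k))
    (hindep : iIndepFun ξ P) (hpos : ∀ k i, P.real {ω | ξ k ω = Pi.single i 1} = p i)
    (hneg : ∀ k i, P.real {ω | ξ k ω = Pi.single i (-1)} = q i) (n : ℕ) :
    P.real (survival ξ n) = binomConv n
      fun i j => (weightNorm (p 0) (q 0) i * if Even i then 1 else rate (p 0) (q 0))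
        * (weightNorm (p 1) (q 1) j * if Even j then 1 else rate (p 1) (q 1)) := by
  rw [measureReal_survival hsum hmeas hindep hpos hneg]
  refine binomConv_congr fun i j hij => ?_
  rw [sum_stayWeight_eq_weightNorm (hp 0) (hq 0) (by omega),
    sum_stayWeight_eq_weightNorm (hp 1) (hq 1) (by omega)]

lemma measureReal_survival_pos (hp : ∀ i, 0 < p i) (hq : ∀ i, 0 < q i)
    (hsum : ∑ i, (p i + q i) = 1) (hmeas : ∀ k, Measurable (ξ k))
    (hindep : iIndepFun ξ P) (hpos : ∀ k i, P.real {ω | ξ k ω = Pi.single i 1} = p i)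
    (hneg : ∀ k i, P.real {ω | ξ k ω = Pi.single i (-1)} = q i) (n : ℕ) :
    0 < P.real (survival ξ n) := by
  rw [measureReal_survival_eq hp hq hsum hmeas hindep hpos hneg]
  refine binomConv_pos (V := fun i => weightNorm (p 0) (q 0) i * if Even i then 1 else _)
    (W := fun j => weightNorm (p 1) (q 1) j * if Even j then 1 else _) (fun k => ?_)
    (fun k => ?_) n
  · refine mul_pos (weightNorm_pos (hp 0) (hq 0) k) ?_
    split_ifs
    exacts [one_pos, rate_pos (hp 0) (hq 0)]
  · refine mul_pos (weightNorm_pos (hp 1) (hq 1) k) ?_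
    split_ifs
    exacts [one_pos, rate_pos (hp 1) (hq 1)]

/-- The limits of the conditional probabilities of the numbers of returns. -/
theorem tendsto_returnEvent (hp : ∀ i, 0 < p i) (hq : ∀ i, 0 < q i)
    (hsum : ∑ i, (p i + q i) = 1) (hmeas : ∀ k, Measurable (ξ k))
    (hindep : iIndepFun ξ P) (hpos : ∀ k i, P.real {ω | ξ k ω = Pi.single i 1} = p i)
    (hneg : ∀ k i, P.real {ω | ξ k ω = Pi.single i (-1)} = q i) (r s : ℕ) :
    Tendsto (fun n => P.real (returnEvent ξ (2 * n) r s) / P.real (survival ξ (2 * n))) atTop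
      (𝓝 ((evenLim (p 0 / (p 0 + q 0)) (q 0 / (p 0 + q 0)) r
            * evenLim (p 1 / (p 1 + q 1)) (q 1 / (p 1 + q 1)) s
          + rate (p 0) (q 0) * rate (p 1) (q 1)
            * (oddLim (p 0 / (p 0 + q 0)) (q 0 / (p 0 + q 0)) r
              * oddLim (p 1 / (p 1 + q 1)) (q 1 / (p 1 + q 1)) s))
        / (1 + rate (p 0) (q 0) * rate (p 1) (q 1)))) := by
  have hV := fun i => weightNorm_pos (hp i) (hq i)
  have hr := fun i => rate_pos (hp i) (hq i)
  have hs : ∀ i, 0 < (p i + q i) * rate (p i) (q i) :=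
    fun i => mul_pos (add_pos (hp i) (hq i)) (hr i)
  have h1 := tendsto_binomConv_parity (hs 0) (hs 1) (hV 0) (hV 1)
    (tendsto_weightNorm_ratio (hp 0) (hq 0)) (tendsto_weightNorm_ratio (hp 1) (hq 1))
    (tendsto_stayWeight_div_weightNorm (hp 0) (hq 0) r)
    (tendsto_stayWeight_div_weightNorm (hp 1) (hq 1) s)
  -- The survival probability is the same kind of convolution, with parity constants `1` and the
  -- rate; the factor `1/2` from the parity balance cancels in the quotient.
  have hconst : ∀ i, Tendsto (fun k => (weightNorm (p i) (q i) k
      * if Even k then 1 else rate (p i) (q i)) / weightNorm (p i) (q i) k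
      - if Even k then 1 else rate (p i) (q i)) atTop (𝓝 0) := fun i => by
    refine tendsto_const_nhds.congr fun k => ?_
    rw [mul_div_cancel_left₀ _ (hV i k).ne', sub_self]
  have h2 := tendsto_binomConv_parity (hs 0) (hs 1) (hV 0) (hV 1)
    (tendsto_weightNorm_ratio (hp 0) (hq 0)) (tendsto_weightNorm_ratio (hp 1) (hq 1))
    (hconst 0) (hconst 1)
  have hne : (1 * 1 + rate (p 0) (q 0) * rate (p 1) (q 1)) / 2 ≠ 0 := by
    have := mul_pos (hr 0) (hr 1)
    positivity
  have h3 := h1.div h2 hne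
  rw [div_div_div_cancel_right₀ two_ne_zero, one_mul, mul_mul_mul_comm] at h3
  refine h3.congr fun n => ?_
  rw [measureReal_returnEvent hsum hmeas hindep hpos hneg,
    measureReal_survival_eq hp hq hsum hmeas hindep hpos hneg]
  exact div_div_div_cancel_right₀ (binomConv_pos (hV 0) (hV 1) (2 * n)).ne' _ _

end MassLimits

/-! ### Limit laws, mixtures of products, and weak convergence. -/

section Laws

open Topology

variable {P Q : ℝ}

lemma tendsto_excPowLim (P Q : ℝ) : Tendsto (excPowLim P Q) atTop (𝓝 0) := by
  have h := (tendsto_self_mul_const_pow_of_lt_one (r := 1 / 2) (by norm_num) (by norm_num)).mul_const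
    (2 * excRatio P Q)
  rw [zero_mul] at h
  refine h.congr fun n => ?_
  rw [excPowLim, div_pow, one_pow]
  ring

lemma tendsto_stayPowLim (hP : 0 < P) (hQ : 0 < Q) (hPQ : P + Q = 1) :
    Tendsto (stayPowLim P Q) atTop (𝓝 0) := by
  rcases le_or_gt Q P with h | h
  · exact (tendsto_pow_atTop_nhds_zero_of_lt_one hQ.le (by linarith)).congr
      fun r => (stayPowLim_of_le h r).symm
  · have h1 := (tendsto_self_mul_const_pow_of_lt_one (r := 1 / 2) (by norm_num)
      (by norm_num)).mul_const (Q - P)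
    have h2 := tendsto_pow_atTop_nhds_zero_of_lt_one (r := (1 / 2 : ℝ)) (by norm_num) (by norm_num)
    have h3 := h2.add h1
    rw [zero_mul, add_zero] at h3
    refine h3.congr fun r => ?_
    rw [stayPowLim_of_lt hPQ h, div_pow, one_pow]
    ring

lemma evenLim_nonneg (hP : 0 < P) (hQ : 0 < Q) (hPQ : P + Q = 1) (r : ℕ) : 0 ≤ evenLim P Q r := by
  rcases le_or_gt Q P with h | h
  · rw [evenLim_of_le hPQ h]
    have : 0 ≤ 1 - P := by linarith
    positivity
  · rw [evenLim, stayPowLim_of_lt hPQ h, stayPowLim_of_lt hPQ h, sub_nonneg, pow_succ,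
      div_le_div_iff₀ (by positivity) (by positivity)]
    push_cast
    have h1 : 0 ≤ (r : ℝ) * (Q - P) := mul_nonneg (Nat.cast_nonneg _) (by linarith)
    have h2 : (0 : ℝ) < 2 ^ r := by positivity
    nlinarith

lemma oddLim_nonneg (hP : 0 < P) (hQ : 0 < Q) (hPQ : P + Q = 1) (r : ℕ) : 0 ≤ oddLim P Q r := by
  rcases le_or_gt Q P with h | h
  · rw [oddLim_of_le hPQ h]
    have : 0 ≤ 1 - P := by linarith
    positivity
  · have h1 := oddLim_of_lt hP h r
    rw [hPQ, div_one, div_one] at h1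
    rw [h1, phiOdd, hPQ]
    have h2 : 1 / (2 * Q) ≤ 1 := by rw [div_le_one (by positivity)]; linarith
    have h3 : 0 ≤ 1 - 1 / (2 * Q) := by linarith
    positivity

/-- The sum telescopes and no mass escapes to infinity, so convergence of point masses will suffice
for weak convergence. -/
lemma hasSum_evenLim (hP : 0 < P) (hQ : 0 < Q) (hPQ : P + Q = 1) : HasSum (evenLim P Q) 1 := by
  rw [hasSum_iff_tendsto_nat_of_nonneg (evenLim_nonneg hP hQ hPQ)]
  simp only [evenLim, Finset.sum_range_sub']
  simpa [stayPowLim] using (tendsto_stayPowLim hP hQ hPQ).const_sub 1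

lemma hasSum_oddLim (hP : 0 < P) (hQ : 0 < Q) (hPQ : P + Q = 1) : HasSum (oddLim P Q) 1 := by
  rw [hasSum_iff_tendsto_nat_of_nonneg (oddLim_nonneg hP hQ hPQ)]
  simp only [oddLim, Finset.sum_sub_distrib (f := fun r => stayPowLim P Q r - stayPowLim P Q (r + 1)),
    Finset.sum_range_sub']
  have h := ((tendsto_stayPowLim hP hQ hPQ).const_sub 1).add (tendsto_excPowLim P Q)
  rw [sub_zero, add_zero] at h
  refine h.congr fun n => ?_
  have h0 : excPowLim P Q 0 = 0 := by simp [excPowLim]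
  rw [h0, stayPowLim]
  ring

/-- The measure on `ℕ` with masses `f`. -/
noncomputable def massLaw (f : ℕ → ℝ) : Measure ℕ :=
  Measure.sum fun n => ENNReal.ofReal (f n) • Measure.dirac n

lemma massLaw_real_singleton {f : ℕ → ℝ} (hf : ∀ n, 0 ≤ f n) (n : ℕ) :
    (massLaw f).real {n} = f n := by
  rw [measureReal_def, massLaw, Measure.sum_smul_dirac_singleton, ENNReal.toReal_ofReal (hf n)]

lemma isProbabilityMeasure_massLaw {f : ℕ → ℝ} (hf : ∀ n, 0 ≤ f n) (h : HasSum f 1) :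
    IsProbabilityMeasure (massLaw f) := h.isProbabilityMeasure_sum_dirac hf

lemma massLaw_evenLim_of_le {p q : ℝ} (hp : 0 < p) (hq : 0 < q) (h : q ≤ p) :
    massLaw (evenLim (p / (p + q)) (q / (p + q))) = geometricMeasure (upProb hp hq) := by
  have h0 : upProb hp hq ≠ 0 := by
    intro h
    have : p / (p + q) = 0 := congrArg Subtype.val h
    have : 0 < p / (p + q) := by positivity
    linarith
  rw [geometricMeasure_eq h0, massLaw]
  simp only [evenLim_of_le (normalized_add hp hq) (show q / (p + q) ≤ p / (p + q) by gcongr)]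
  rfl

lemma massLaw_oddLim_of_le {p q : ℝ} (hp : 0 < p) (hq : 0 < q) (h : q ≤ p) :
    massLaw (oddLim (p / (p + q)) (q / (p + q))) = geometricMeasure (upProb hp hq) := by
  rw [← massLaw_evenLim_of_le hp hq h]
  have h1 : q / (p + q) ≤ p / (p + q) := by gcongr
  congr 1
  funext r
  rw [oddLim_of_le (normalized_add hp hq) h1, evenLim_of_le (normalized_add hp hq) h1]

/-- The mixture of two product measures, as a measure on pairs indexed by `Fin 2`. -/
noncomputable def mixture (c d : ℝ) (μ μ' ν ν' : Measure ℕ) : Measure (Fin 2 → ℕ) :=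
  (ENNReal.ofReal c • μ.prod μ' + ENNReal.ofReal d • ν.prod ν').map fun z => ![z.1, z.2]

variable {c d : ℝ} {μ μ' ν ν' : Measure ℕ} [IsProbabilityMeasure μ] [IsProbabilityMeasure μ']
  [IsProbabilityMeasure ν] [IsProbabilityMeasure ν']

lemma mixture_real (hc : 0 ≤ c) (hd : 0 ≤ d) (S T : Set ℕ) :
    (mixture c d μ μ' ν ν').real {x | x 0 ∈ S ∧ x 1 ∈ T}
      = c * (μ.real S * μ'.real T) + d * (ν.real S * ν'.real T) := by
  have h1 : (fun z : ℕ × ℕ => ![z.1, z.2]) ⁻¹' {x | x 0 ∈ S ∧ x 1 ∈ T} = S ×ˢ T := by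
    ext z
    simp
  rw [measureReal_def, mixture, Measure.map_apply (measurable_of_countable _) .of_discrete, h1,
    Measure.add_apply, Measure.smul_apply, Measure.smul_apply, Measure.prod_prod,
    Measure.prod_prod, smul_eq_mul, smul_eq_mul,
    ENNReal.toReal_add (by finiteness) (by finiteness)]
  simp [ENNReal.toReal_mul, ENNReal.toReal_ofReal hc, ENNReal.toReal_ofReal hd, measureReal_def]

lemma isProbabilityMeasure_mixture (hc : 0 ≤ c) (hd : 0 ≤ d) (hcd : c + d = 1) :
    IsProbabilityMeasure (mixture c d μ μ' ν ν') := by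
  have h := mixture_real (μ := μ) (μ' := μ') (ν := ν) (ν' := ν') hc hd Set.univ Set.univ
  simp only [Set.mem_univ, and_self, Set.ofPred_true, probReal_univ, mul_one, hcd] at h
  exact ⟨by rwa [measureReal_def, ENNReal.toReal_eq_one_iff] at h⟩

lemma mixture_real_fst (hc : 0 ≤ c) (hd : 0 ≤ d) (S : Set ℕ) :
    (mixture c d μ μ' ν ν').real {x | x 0 ∈ S} = c * μ.real S + d * ν.real S := by
  have h := mixture_real (μ := μ) (μ' := μ') (ν := ν) (ν' := ν') hc hd S Set.univ
  simpa using h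

lemma mixture_real_snd (hc : 0 ≤ c) (hd : 0 ≤ d) (T : Set ℕ) :
    (mixture c d μ μ' ν ν').real {x | x 1 ∈ T} = c * μ'.real T + d * ν'.real T := by
  have h := mixture_real (μ := μ) (μ' := μ') (ν := ν) (ν' := ν') hc hd Set.univ T
  simpa using h

lemma indepFun_coords_iff {ρ : Measure (Fin 2 → ℕ)} [IsFiniteMeasure ρ] :
    IndepFun (fun x : Fin 2 → ℕ => x 0) (fun x : Fin 2 → ℕ => x 1) ρ ↔
      ∀ S T : Set ℕ, ρ.real {x | x 0 ∈ S ∧ x 1 ∈ T}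
        = ρ.real {x | x 0 ∈ S} * ρ.real {x | x 1 ∈ T} := by
  rw [indepFun_iff_measure_inter_preimage_eq_mul]
  constructor
  · intro h S T
    rw [measureReal_def, measureReal_def, measureReal_def, ← ENNReal.toReal_mul]
    exact congrArg ENNReal.toReal (h S T .of_discrete .of_discrete)
  · intro h S T _ _
    have h1 := h S T
    rw [measureReal_def, measureReal_def, measureReal_def, ← ENNReal.toReal_mul,
      ENNReal.toReal_eq_toReal_iff' (by finiteness) (by finiteness)] at h1
    exact h1

/-- A common second factor comes out of the mixture, leaving a product measure. -/
lemma indepFun_mixture_of_snd_eq (hc : 0 ≤ c) (hd : 0 ≤ d) (hcd : c + d = 1) (h : μ' = ν') :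
    IndepFun (fun x : Fin 2 → ℕ => x 0) (fun x : Fin 2 → ℕ => x 1) (mixture c d μ μ' ν ν') := by
  have := isProbabilityMeasure_mixture (μ := μ) (μ' := μ') (ν := ν) (ν' := ν') hc hd hcd
  rw [indepFun_coords_iff]
  intro S T
  rw [mixture_real hc hd, mixture_real_fst hc hd, mixture_real_snd hc hd, h]
  linear_combination (-(c * μ.real S + d * ν.real S) * ν'.real T) * hcd

lemma indepFun_mixture_of_fst_eq (hc : 0 ≤ c) (hd : 0 ≤ d) (hcd : c + d = 1) (h : μ = ν) :
    IndepFun (fun x : Fin 2 → ℕ => x 0) (fun x : Fin 2 → ℕ => x 1) (mixture c d μ μ' ν ν') := by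
  have := isProbabilityMeasure_mixture (μ := μ) (μ' := μ') (ν := ν) (ν' := ν') hc hd hcd
  rw [indepFun_coords_iff]
  intro S T
  rw [mixture_real hc hd, mixture_real_fst hc hd, mixture_real_snd hc hd, h]
  linear_combination (-(c * μ'.real T + d * ν'.real T) * ν.real S) * hcd

/-- The defect of independence on `S × T` is `c d (μ S - ν S) (μ' T - ν' T)`. -/
lemma not_indepFun_mixture (hc : 0 < c) (hd : 0 < d) (hcd : c + d = 1) {S T : Set ℕ}
    (hS : μ.real S ≠ ν.real S) (hT : μ'.real T ≠ ν'.real T) :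
    ¬ IndepFun (fun x : Fin 2 → ℕ => x 0) (fun x : Fin 2 → ℕ => x 1) (mixture c d μ μ' ν ν') := by
  have := isProbabilityMeasure_mixture (μ := μ) (μ' := μ') (ν := ν) (ν' := ν') hc.le hd.le hcd
  rw [indepFun_coords_iff]
  intro h
  have h1 := h S T
  rw [mixture_real hc.le hd.le, mixture_real_fst hc.le hd.le, mixture_real_snd hc.le hd.le] at h1
  have h2 : c * d * ((μ.real S - ν.real S) * (μ'.real T - ν'.real T)) = 0 := by
    obtain rfl : d = 1 - c := by linarith
    linear_combination h1
  have h3 : c * d * ((μ.real S - ν.real S) * (μ'.real T - ν'.real T)) ≠ 0 :=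
    mul_ne_zero (mul_pos hc hd).ne' (mul_ne_zero (sub_ne_zero.2 hS) (sub_ne_zero.2 hT))
  exact h3 h2

lemma hasLaw_mixture_fst (hc : 0 ≤ c) (hd : 0 ≤ d) (hcd : c + d = 1) (h : μ = ν) :
    HasLaw (fun x : Fin 2 → ℕ => x 0) ν (mixture c d μ μ' ν ν') := by
  have := isProbabilityMeasure_mixture (μ := μ) (μ' := μ') (ν := ν) (ν' := ν') hc hd hcd
  refine ⟨(measurable_pi_apply 0).aemeasurable, ?_⟩
  rw [ext_iff_measureReal_singleton]
  intro n
  rw [map_measureReal_apply (measurable_pi_apply 0) (measurableSet_singleton n)]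
  refine (mixture_real_fst hc hd {n}).trans ?_
  rw [h, ← add_mul, hcd, one_mul]

lemma hasLaw_mixture_snd (hc : 0 ≤ c) (hd : 0 ≤ d) (hcd : c + d = 1) (h : μ' = ν') :
    HasLaw (fun x : Fin 2 → ℕ => x 1) ν' (mixture c d μ μ' ν ν') := by
  have := isProbabilityMeasure_mixture (μ := μ) (μ' := μ') (ν := ν) (ν' := ν') hc hd hcd
  refine ⟨(measurable_pi_apply 1).aemeasurable, ?_⟩
  rw [ext_iff_measureReal_singleton]
  intro n
  rw [map_measureReal_apply (measurable_pi_apply 1) (measurableSet_singleton n)]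
  refine (mixture_real_snd hc hd {n}).trans ?_
  rw [h, ← add_mul, hcd, one_mul]

/-- On a countable discrete measurable space, convergence of the masses of the points to those of a
probability measure implies weak convergence. -/
lemma tendsto_probabilityMeasure_of_singleton {E : Type*} [MeasurableSpace E] [Countable E]
    [DiscreteMeasurableSpace E] [TopologicalSpace E] [OpensMeasurableSpace E]
    {μs : ℕ → ProbabilityMeasure E} {μ : ProbabilityMeasure E}
    (h : ∀ x, Tendsto (fun n => (μs n : Measure E) {x}) atTop (𝓝 ((μ : Measure E) {x}))) :
    Tendsto μs atTop (𝓝 μ) := by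
  refine tendsto_of_forall_isOpen_le_liminf' fun G _ => ?_
  have hG : MeasurableSet G := .of_discrete
  have hrep : ∀ m : Measure E, m G = ∫⁻ x, G.indicator (fun x => m {x}) x ∂Measure.count := by
    intro m
    rw [lintegral_count, Measure.tsum_indicator_apply_singleton m G hG]
  simp only [hrep]
  -- Fatou's lemma for the counting measure gives the open-set criterion of the portmanteau theorem.
  refine le_trans (le_of_eq (lintegral_congr fun x => ?_))
    (lintegral_liminf_le fun n => measurable_of_countable _)
  symm
  apply Tendsto.liminf_eq
  by_cases hx : x ∈ G
  · simpa only [Set.indicator_of_mem hx] using h x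
  · simpa only [Set.indicator_of_notMem hx] using tendsto_const_nhds

end Laws

/-! ### Assembly of the limit law. -/

section MainTheorem

open Topology

variable {Ω : Type*} [MeasurableSpace Ω] {P : Measure Ω}
  {ξ : ℕ → Ω → Fin 2 → ℤ}

lemma map_cond_returns_singleton (hmeas : ∀ k, Measurable (ξ k)) (n : ℕ) (x : Fin 2 → ℕ) :
    ((P[|survival ξ n]).map fun ω i => returns ξ i n ω).real {x}
      = P.real (returnEvent ξ n (x 0) (x 1)) / P.real (survival ξ n) := by
  have hm : Measurable fun ω i => returns ξ i n ω :=
    measurable_pi_lambda _ fun i => measurable_returns hmeas i n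
  rw [map_measureReal_apply hm (measurableSet_singleton x), measureReal_def,
    cond_apply (measurableSet_survival hmeas n), ENNReal.toReal_mul, ENNReal.toReal_inv,
    inv_mul_eq_div]
  congr 3
  ext ω
  simp [returnEvent, funext_iff, Fin.forall_fin_two]
  tauto

/-- The limit law of the numbers of returns. -/
noncomputable def limitLaw (p q : Fin 2 → ℝ) : Measure (Fin 2 → ℕ) :=
  mixture (1 / (1 + rate (p 0) (q 0) * rate (p 1) (q 1)))
    (rate (p 0) (q 0) * rate (p 1) (q 1) / (1 + rate (p 0) (q 0) * rate (p 1) (q 1)))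
    (massLaw (evenLim (p 0 / (p 0 + q 0)) (q 0 / (p 0 + q 0))))
    (massLaw (evenLim (p 1 / (p 1 + q 1)) (q 1 / (p 1 + q 1))))
    (massLaw (oddLim (p 0 / (p 0 + q 0)) (q 0 / (p 0 + q 0))))
    (massLaw (oddLim (p 1 / (p 1 + q 1)) (q 1 / (p 1 + q 1))))

lemma isProbabilityMeasure_massLaw_evenLim {a b : ℝ} (ha : 0 < a) (hb : 0 < b) :
    IsProbabilityMeasure (massLaw (evenLim (a / (a + b)) (b / (a + b)))) :=
  isProbabilityMeasure_massLaw
    (evenLim_nonneg (by positivity) (by positivity) (normalized_add ha hb))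
    (hasSum_evenLim (by positivity) (by positivity) (normalized_add ha hb))

lemma isProbabilityMeasure_massLaw_oddLim {a b : ℝ} (ha : 0 < a) (hb : 0 < b) :
    IsProbabilityMeasure (massLaw (oddLim (a / (a + b)) (b / (a + b)))) :=
  isProbabilityMeasure_massLaw
    (oddLim_nonneg (by positivity) (by positivity) (normalized_add ha hb))
    (hasSum_oddLim (by positivity) (by positivity) (normalized_add ha hb))

lemma massLaw_evenLim_real {a b : ℝ} (ha : 0 < a) (hb : 0 < b) (r : ℕ) :
    (massLaw (evenLim (a / (a + b)) (b / (a + b)))).real {r}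
      = evenLim (a / (a + b)) (b / (a + b)) r :=
  massLaw_real_singleton
    (evenLim_nonneg (by positivity) (by positivity) (normalized_add ha hb)) r

lemma massLaw_oddLim_real {a b : ℝ} (ha : 0 < a) (hb : 0 < b) (r : ℕ) :
    (massLaw (oddLim (a / (a + b)) (b / (a + b)))).real {r}
      = oddLim (a / (a + b)) (b / (a + b)) r :=
  massLaw_real_singleton
    (oddLim_nonneg (by positivity) (by positivity) (normalized_add ha hb)) r

/-- Equality would mean `4ab = (a + b)²`, that is `a = b`. -/
lemma phiEven_zero_ne_phiOdd_zero {a b : ℝ} (ha : 0 < a) (hab : a < b) :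
    phiEven a b 0 ≠ phiOdd a b 0 := by
  have hb : 0 < b := ha.trans hab
  intro h
  rw [phiEven, phiOdd] at h
  simp only [Nat.cast_zero, mul_zero, add_zero] at h
  rw [div_left_inj' (by positivity), div_eq_div_iff (by positivity) (by positivity)] at h
  nlinarith [mul_pos (sub_pos.2 hab) (sub_pos.2 hab)]

end MainTheorem

end QuadrantWalk

open QuadrantWalk

theorem theorem1p3 {Ω : Type*} [MeasurableSpace Ω] (P : Measure Ω) [IsProbabilityMeasure P]
    (p q : Fin 2 → ℝ) (hp : ∀ i, 0 < p i) (hq : ∀ i, 0 < q i) (hsum : ∑ i, (p i + q i) = 1)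
    (ξ : ℕ → Ω → Fin 2 → ℤ) (hmeas : ∀ k, Measurable (ξ k)) (hindep : iIndepFun ξ P)
    (hpos : ∀ k i, P.real {ω | ξ k ω = Pi.single i 1} = p i)
    (hneg : ∀ k i, P.real {ω | ξ k ω = Pi.single i (-1)} = q i) :
    ∃ (_ : ∀ n : ℕ, IsProbabilityMeasure (P[|QuadrantWalk.survival ξ (2 * n)]))
      (ν : Measure (Fin 2 → ℕ)) (_ : IsProbabilityMeasure ν),
      TendstoInDistribution (fun (n : ℕ) ω i => QuadrantWalk.returns ξ i (2 * n) ω) atTop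
        (fun x : Fin 2 → ℕ => x) (fun n : ℕ => P[|QuadrantWalk.survival ξ (2 * n)]) ν ∧
      ((∀ i, q i ≤ p i) →
        IndepFun (fun x : Fin 2 → ℕ => x 0) (fun x : Fin 2 → ℕ => x 1) ν ∧
        ∀ i, HasLaw (fun x : Fin 2 → ℕ => x i)
          (geometricMeasure (QuadrantWalk.upProb (hp i) (hq i))) ν) ∧
      (∀ i j, i ≠ j → p i < q i → q j ≤ p j →
        IndepFun (fun x : Fin 2 → ℕ => x i) (fun x : Fin 2 → ℕ => x j) ν ∧
        (∀ r : ℕ, ν.real {x | x i = r} =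
          (QuadrantWalk.phiEven (p i) (q i) r
            + QuadrantWalk.rho (p i) (q i) * QuadrantWalk.phiOdd (p i) (q i) r)
            / (1 + QuadrantWalk.rho (p i) (q i))) ∧
        HasLaw (fun x : Fin 2 → ℕ => x j)
          (geometricMeasure (QuadrantWalk.upProb (hp j) (hq j))) ν) ∧
      ((∀ i, p i < q i) →
        ¬ IndepFun (fun x : Fin 2 → ℕ => x 0) (fun x : Fin 2 → ℕ => x 1) ν ∧
        ∀ r₁ r₂ : ℕ, ν.real {x | x 0 = r₁ ∧ x 1 = r₂} =
          (QuadrantWalk.phiEven (p 0) (q 0) r₁ * QuadrantWalk.phiEven (p 1) (q 1) r₂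
            + QuadrantWalk.rho (p 0) (q 0) * QuadrantWalk.rho (p 1) (q 1)
              * (QuadrantWalk.phiOdd (p 0) (q 0) r₁ * QuadrantWalk.phiOdd (p 1) (q 1) r₂))
            / (1 + QuadrantWalk.rho (p 0) (q 0) * QuadrantWalk.rho (p 1) (q 1))) := by
  have hE0 := isProbabilityMeasure_massLaw_evenLim (hp 0) (hq 0)
  have hE1 := isProbabilityMeasure_massLaw_evenLim (hp 1) (hq 1)
  have hO0 := isProbabilityMeasure_massLaw_oddLim (hp 0) (hq 0)
  have hO1 := isProbabilityMeasure_massLaw_oddLim (hp 1) (hq 1)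
  have hr := mul_pos (rate_pos (hp 0) (hq 0)) (rate_pos (hp 1) (hq 1))
  have hc : 0 < 1 / (1 + rate (p 0) (q 0) * rate (p 1) (q 1)) := by positivity
  have hd : 0 < rate (p 0) (q 0) * rate (p 1) (q 1)
    / (1 + rate (p 0) (q 0) * rate (p 1) (q 1)) := by positivity
  have hcd : 1 / (1 + rate (p 0) (q 0) * rate (p 1) (q 1)) + rate (p 0) (q 0) * rate (p 1) (q 1)
    / (1 + rate (p 0) (q 0) * rate (p 1) (q 1)) = 1 := by field_simp
  have hν : IsProbabilityMeasure (limitLaw p q) := isProbabilityMeasure_mixture hc.le hd.le hcd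
  have hcond : ∀ n : ℕ, IsProbabilityMeasure (P[|survival ξ (2 * n)]) := fun n =>
    cond_isProbabilityMeasure fun h0 => by
      have := measureReal_survival_pos hp hq hsum hmeas hindep hpos hneg (2 * n)
      rw [measureReal_def, h0, ENNReal.toReal_zero] at this
      exact lt_irrefl _ this
  have hmass : ∀ r s : ℕ, (limitLaw p q).real {x | x 0 = r ∧ x 1 = s}
      = (evenLim (p 0 / (p 0 + q 0)) (q 0 / (p 0 + q 0)) r
            * evenLim (p 1 / (p 1 + q 1)) (q 1 / (p 1 + q 1)) s
          + rate (p 0) (q 0) * rate (p 1) (q 1)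
            * (oddLim (p 0 / (p 0 + q 0)) (q 0 / (p 0 + q 0)) r
              * oddLim (p 1 / (p 1 + q 1)) (q 1 / (p 1 + q 1)) s))
        / (1 + rate (p 0) (q 0) * rate (p 1) (q 1)) := by
    intro r s
    refine (mixture_real hc.le hd.le {r} {s}).trans ?_
    rw [massLaw_evenLim_real (hp 0) (hq 0), massLaw_evenLim_real (hp 1) (hq 1),
      massLaw_oddLim_real (hp 0) (hq 0), massLaw_oddLim_real (hp 1) (hq 1)]
    ring
  refine ⟨hcond, limitLaw p q, hν, ?_, ?_, ?_, ?_⟩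
  · have hm : ∀ n, Measurable fun ω i => returns ξ i (2 * n) ω := fun n =>
      measurable_pi_lambda _ fun i => measurable_returns hmeas i (2 * n)
    refine ⟨fun n => (hm n).aemeasurable, measurable_id.aemeasurable, ?_⟩
    refine tendsto_probabilityMeasure_of_singleton fun x => ?_
    have hid : (limitLaw p q).map (fun x => x) = limitLaw p q := Measure.map_id
    simp only [ProbabilityMeasure.coe_mk, hid]
    have h1 := tendsto_returnEvent hp hq hsum hmeas hindep hpos hneg (x 0) (x 1)
    rw [← hmass] at h1
    have h2 : {y : Fin 2 → ℕ | y 0 = x 0 ∧ y 1 = x 1} = {x} := by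
      ext y
      simp [funext_iff, Fin.forall_fin_two]
    rw [h2] at h1
    simp only [← map_cond_returns_singleton hmeas] at h1
    have := fun n => Measure.isProbabilityMeasure_map (μ := P[|survival ξ (2 * n)])
      (hm n).aemeasurable
    exact (ENNReal.tendsto_toReal_iff (fun n => measure_ne_top _ _) (measure_ne_top _ _)).1 h1
  · intro h
    have h0 := (massLaw_evenLim_of_le (hp 0) (hq 0) (h 0)).trans
      (massLaw_oddLim_of_le (hp 0) (hq 0) (h 0)).symm
    have h1 := (massLaw_evenLim_of_le (hp 1) (hq 1) (h 1)).trans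
      (massLaw_oddLim_of_le (hp 1) (hq 1) (h 1)).symm
    refine ⟨indepFun_mixture_of_snd_eq hc.le hd.le hcd h1, Fin.forall_fin_two.2 ⟨?_, ?_⟩⟩
    · rw [← massLaw_oddLim_of_le (hp 0) (hq 0) (h 0)]
      exact hasLaw_mixture_fst hc.le hd.le hcd h0
    · rw [← massLaw_oddLim_of_le (hp 1) (hq 1) (h 1)]
      exact hasLaw_mixture_snd hc.le hd.le hcd h1
  · intro i j hij hi hj
    have hj' := (massLaw_evenLim_of_le (hp j) (hq j) hj).trans
      (massLaw_oddLim_of_le (hp j) (hq j) hj).symm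
    rw [← rate_of_lt (hp i) hi, ← massLaw_oddLim_of_le (hp j) (hq j) hj]
    -- A rate of `1` in coordinate `j` leaves the mixture weights `1 : ρ_i` for coordinate `i`.
    have hj1 := rate_of_le (hp j) (hq j) hj
    have he := evenLim_of_lt (hp i) hi
    have ho := oddLim_of_lt (hp i) hi
    obtain ⟨rfl, rfl⟩ | ⟨rfl, rfl⟩ : (i = 0 ∧ j = 1) ∨ (i = 1 ∧ j = 0) := by omega
    · refine ⟨indepFun_mixture_of_snd_eq hc.le hd.le hcd hj', fun r => ?_,
        hasLaw_mixture_snd hc.le hd.le hcd hj'⟩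
      refine (mixture_real_fst hc.le hd.le {r}).trans ?_
      rw [massLaw_evenLim_real (hp 0) (hq 0), massLaw_oddLim_real (hp 0) (hq 0), he, ho, hj1]
      ring
    · refine ⟨(indepFun_mixture_of_fst_eq hc.le hd.le hcd hj').symm, fun r => ?_,
        hasLaw_mixture_fst hc.le hd.le hcd hj'⟩
      refine (mixture_real_snd hc.le hd.le {r}).trans ?_
      rw [massLaw_evenLim_real (hp 1) (hq 1), massLaw_oddLim_real (hp 1) (hq 1), he, ho, hj1]
      ring
  · intro h
    -- The event of no return separates the even law from the odd law in each coordinate.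
    refine ⟨not_indepFun_mixture hc hd hcd (S := {0}) (T := {0}) ?_ ?_, fun r s => ?_⟩
    · rw [massLaw_evenLim_real (hp 0) (hq 0), massLaw_oddLim_real (hp 0) (hq 0),
        evenLim_of_lt (hp 0) (h 0), oddLim_of_lt (hp 0) (h 0)]
      exact phiEven_zero_ne_phiOdd_zero (hp 0) (h 0)
    · rw [massLaw_evenLim_real (hp 1) (hq 1), massLaw_oddLim_real (hp 1) (hq 1),
        evenLim_of_lt (hp 1) (h 1), oddLim_of_lt (hp 1) (h 1)]
      exact phiEven_zero_ne_phiOdd_zero (hp 1) (h 1)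
    · rw [hmass, evenLim_of_lt (hp 0) (h 0), oddLim_of_lt (hp 0) (h 0),
        evenLim_of_lt (hp 1) (h 1), oddLim_of_lt (hp 1) (h 1), rate_of_lt (hp 0) (h 0),
        rate_of_lt (hp 1) (h 1)]
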